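/- **Theorem.** Work in the randomized word RAM model with words of $\Theta(\log n)$ bits (unit cost for arithmetic, comparisons, memory access, drawing a uniformly random word, and reporting one edge change of the output). For every $a \ge 0$ there is a fully dynamic randomized algorithm (one program for all $n$) which, on a graph $G$ on $n \ge 3$ nodes that is initially empty and undergoes an arbitrarily long sequence of edge insertions and edge deletions, maintains an output graph $H$ such that the following holds for every update sequence fixed independently of the random choices of the algorithm (oblivious adversary), where $G_t$ and $H_t$ are the graphs after the first $t$ updates. * *Update time.* After an initialization in time polynomial in $n$, every single update is processed in worst-case time $O(n^{1/2}\log^4 n)$, whatever the random choices are. * *Stretch and size.* For every $t_0 \ge 0$, with probability at least $1 - 1/n^{a}$ it holds simultaneously for all $t$ with $t_0 \le t \le t_0 + n^{a}$ that $H_t$ is a $5$-spanner of $G_t$, i.e. a subgraph $H_t \subseteq G_t$ with $d_{H_t}(u,v) \le 5\, d_{G_t}(u,v)$ for all nodes $u, v$ (distances between disconnected nodes being infinite), and that $H_t$ has $O(n^{3/2}\log^{1/2} n\,\log\log n)$ edges. The constants in the $O$-bounds, in the polynomial and in the word length depend only on $a$. -/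

import Mathlib

open MeasureTheory

/-! ## A randomized word RAM with a step count

Programs are written in a structured imperative language over machine words.  The control structure is
that of a finite program; there are finitely many registers and finitely many arrays in a program, and
every elementary operation (arithmetic, comparison, array access, assignment, test, drawing a random word,
reporting a change of the output) costs one unit of time. -/

/-- Binary operations on machine words.  Comparisons return `1` (true) or `0` (false). -/
inductive BinOp where
  | add | sub | mul | div | mod | lt | eq

/-- The result of an operation on words, where `W` is the number of words (two to the word length):
sums and products are reduced modulo `W`, subtraction is truncated at `0`, division is integer division. -/
def BinOp.eval (W : ℕ) : BinOp → ℕ → ℕ → ℕ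
  | .add, x, y => (x + y) % W
  | .sub, x, y => x - y
  | .mul, x, y => (x * y) % W
  | .div, x, y => x / y
  | .mod, x, y => x % y
  | .lt, x, y => (if x < y then 1 else 0) % W
  | .eq, x, y => (if x = y then 1 else 0) % W

/-- Expressions: constants, registers, array reads (array number `a` at a computed index), operations. -/
inductive Expr where
  | const (k : ℕ)
  | reg (r : ℕ)
  | load (a : ℕ) (i : Expr)
  | op (o : BinOp) (e₁ e₂ : Expr)

/-- Commands.  `rand r` draws a uniformly random word into register `r`.  The commands `report` and
`retract` insert the edge with the two given endpoints into the output graph, respectively delete it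
from the output graph. -/
inductive Cmd where
  | skip
  | assign (r : ℕ) (e : Expr)
  | store (a : ℕ) (i e : Expr)
  | rand (r : ℕ)
  | report (e₁ e₂ : Expr)
  | retract (e₁ e₂ : Expr)
  | seq (p q : Cmd)
  | ite (b : Expr) (p q : Cmd)
  | loop (b : Expr) (p : Cmd)

/-- A machine state: the registers, the arrays, the number of random words drawn so far, and the set of
edges of the output graph (which a program can change but not read). -/
structure MState where
  regs : ℕ → ℕ
  mem : ℕ → ℕ → ℕ
  drawn : ℕ
  out : Finset (Sym2 ℕ)

/-- The value of an expression. -/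
def Expr.eval (W : ℕ) (s : MState) : Expr → ℕ
  | .const k => k % W
  | .reg r => s.regs r
  | .load a i => s.mem a (i.eval W s)
  | .op o e₁ e₂ => o.eval W (e₁.eval W s) (e₂.eval W s)

/-- The time to evaluate an expression: one unit per constant, register access, array access and
operation. -/
def Expr.cost : Expr → ℕ
  | .const _ => 1
  | .reg _ => 1
  | .load _ i => i.cost + 1
  | .op _ e₁ e₂ => e₁.cost + e₂.cost + 1

/-- Assign a value to a register. -/
def MState.setReg (s : MState) (r x : ℕ) : MState :=
  { s with regs := Function.update s.regs r x }

/-- Write a value into array `a` at index `i`. -/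
def MState.setMem (s : MState) (a i x : ℕ) : MState :=
  { s with mem := Function.update s.mem a (Function.update (s.mem a) i x) }

/-- `Exec W ω p s s' k`: on words `0, …, W - 1` and with the random words `ω 0, ω 1, …`, the command `p`
started in state `s` halts after exactly `k` units of time in state `s'`. -/
inductive Exec (W : ℕ) (ω : ℕ → ℕ) : Cmd → MState → MState → ℕ → Prop
  | skip (s : MState) : Exec W ω .skip s s 1
  | assign (s : MState) (r : ℕ) (e : Expr) :
      Exec W ω (.assign r e) s (s.setReg r (e.eval W s)) (e.cost + 1)
  | store (s : MState) (a : ℕ) (i e : Expr) :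
      Exec W ω (.store a i e) s (s.setMem a (i.eval W s) (e.eval W s)) (i.cost + e.cost + 1)
  | rand (s : MState) (r : ℕ) :
      Exec W ω (.rand r) s { s.setReg r (ω s.drawn) with drawn := s.drawn + 1 } 1
  | report (s : MState) (e₁ e₂ : Expr) :
      Exec W ω (.report e₁ e₂) s { s with out := insert s(e₁.eval W s, e₂.eval W s) s.out }
        (e₁.cost + e₂.cost + 1)
  | retract (s : MState) (e₁ e₂ : Expr) :
      Exec W ω (.retract e₁ e₂) s { s with out := s.out.erase s(e₁.eval W s, e₂.eval W s) }
        (e₁.cost + e₂.cost + 1)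
  | seq {p q : Cmd} {s s' s'' : MState} {k l : ℕ} :
      Exec W ω p s s' k → Exec W ω q s' s'' l → Exec W ω (.seq p q) s s'' (k + l)
  | ite_true {b : Expr} {p q : Cmd} {s s' : MState} {k : ℕ} :
      b.eval W s ≠ 0 → Exec W ω p s s' k → Exec W ω (.ite b p q) s s' (b.cost + 1 + k)
  | ite_false {b : Expr} {p q : Cmd} {s s' : MState} {k : ℕ} :
      b.eval W s = 0 → Exec W ω q s s' k → Exec W ω (.ite b p q) s s' (b.cost + 1 + k)
  | loop_done {b : Expr} {p : Cmd} {s : MState} :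
      b.eval W s = 0 → Exec W ω (.loop b p) s s (b.cost + 1)
  | loop_step {b : Expr} {p : Cmd} {s s' s'' : MState} {k l : ℕ} :
      b.eval W s ≠ 0 → Exec W ω p s s' k → Exec W ω (.loop b p) s' s'' l →
      Exec W ω (.loop b p) s s'' (b.cost + 1 + k + l)

/-- The machine is deterministic once its random words are fixed: final state and running time are
determined by the initial state. -/
theorem Exec.unique {W : ℕ} {ω : ℕ → ℕ} {p : Cmd} {s s₁ s₂ : MState} {k₁ k₂ : ℕ}
    (h₁ : Exec W ω p s s₁ k₁) (h₂ : Exec W ω p s s₂ k₂) : s₁ = s₂ ∧ k₁ = k₂ := by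
  induction h₁ generalizing s₂ k₂ with
  | skip | assign | store | rand | report | retract => cases h₂; exact ⟨rfl, rfl⟩
  | seq _ _ ih ih' =>
    cases h₂ with
    | seq h h' =>
      obtain ⟨rfl, rfl⟩ := ih h
      obtain ⟨rfl, rfl⟩ := ih' h'
      exact ⟨rfl, rfl⟩
  | ite_true hb _ ih =>
    cases h₂ with
    | ite_true _ h => obtain ⟨rfl, rfl⟩ := ih h; exact ⟨rfl, rfl⟩
    | ite_false hb' _ => exact absurd hb' hb
  | ite_false hb _ ih =>
    cases h₂ with
    | ite_true hb' _ => exact absurd hb hb'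
    | ite_false _ h => obtain ⟨rfl, rfl⟩ := ih h; exact ⟨rfl, rfl⟩
  | loop_done hb =>
    cases h₂ with
    | loop_done _ => exact ⟨rfl, rfl⟩
    | loop_step hb' _ _ => exact absurd hb hb'
  | loop_step hb _ _ ih ih' =>
    cases h₂ with
    | loop_done hb' => exact absurd hb' hb
    | loop_step _ h h' =>
      obtain ⟨rfl, rfl⟩ := ih h
      obtain ⟨rfl, rfl⟩ := ih' h'
      exact ⟨rfl, rfl⟩

/-! ## Dynamic graphs and spanners -/

/-- An update of a graph on `n` nodes. -/
inductive EdgeUpdate (n : ℕ) where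
  | insert (u v : Fin n)
  | delete (u v : Fin n)

/-- The graph after an update. -/
def EdgeUpdate.apply {n : ℕ} (G : SimpleGraph (Fin n)) : EdgeUpdate n → SimpleGraph (Fin n)
  | .insert u v => G ⊔ SimpleGraph.edge u v
  | .delete u v => G.deleteEdges {s(u, v)}

/-- An update is legal if it inserts a new edge or deletes an existing one. -/
def EdgeUpdate.Legal {n : ℕ} (G : SimpleGraph (Fin n)) : EdgeUpdate n → Prop
  | .insert u v => u ≠ v ∧ ¬ G.Adj u v
  | .delete u v => G.Adj u v

/-- The graph after the first `t` updates, starting from the empty graph. -/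
def graphAt {n : ℕ} (σ : ℕ → EdgeUpdate n) : ℕ → SimpleGraph (Fin n)
  | 0 => ⊥
  | t + 1 => (σ t).apply (graphAt σ t)

/-- `H` is an `α`-spanner of `G`: a subgraph on the same nodes with `d_H(u, v) ≤ α · d_G(u, v)` for all
nodes `u`, `v`, where distances between disconnected nodes are infinite. -/
def IsSpanner {V : Type*} (α : ℕ) (G H : SimpleGraph V) : Prop :=
  H ≤ G ∧ ∀ u v : V, H.edist u v ≤ (α : ℕ∞) * G.edist u v

/-- The edges in the output of the machine are exactly those of `H`. -/
def MState.Outputs {n : ℕ} (s : MState) (H : SimpleGraph (Fin n)) : Prop :=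
  (s.out : Set (Sym2 ℕ)) = Sym2.map (fun v : Fin n => (v : ℕ)) '' H.edgeSet

/-! ## Fully dynamic algorithms -/

/-- A fully dynamic graph algorithm consists of a program that is run once, on the empty graph, and a
program that is run after every update. -/
structure DynAlgorithm where
  init : Cmd
  update : Cmd

/-- The initial state: register `0` holds the number of nodes, everything else is zero, and the output
graph has no edges. -/
def MState.start (n : ℕ) : MState where
  regs := fun r => if r = 0 then n else 0
  mem := fun _ _ => 0
  drawn := 0
  out := ∅

/-- An update is passed to the algorithm in the registers `1` (`1` for an insertion, `0` for a deletion)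
and `2`, `3` (the endpoints). -/
def MState.feed {n : ℕ} (s : MState) : EdgeUpdate n → MState
  | .insert u v => ((s.setReg 1 1).setReg 2 u).setReg 3 v
  | .delete u v => ((s.setReg 1 0).setReg 2 u).setReg 3 v

/-- The run of an algorithm on the update sequence `σ`, with the random words `ω` and words
`0, …, W - 1`: `st t` is the state after the first `t` updates, `k₀` is the time for the initialization,
and `k t` is the time spent on the update `σ t`. -/
def DynAlgorithm.IsRun (A : DynAlgorithm) (W : ℕ) (ω : ℕ → ℕ) {n : ℕ} (σ : ℕ → EdgeUpdate n)
    (st : ℕ → MState) (k₀ : ℕ) (k : ℕ → ℕ) : Prop :=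
  Exec W ω A.init (MState.start n) (st 0) k₀ ∧
    ∀ t, Exec W ω A.update ((st t).feed (σ t)) (st (t + 1)) (k t)

/-- The word length for graphs on `n` nodes: a constant multiple of `log n`. -/
def wordLength (c n : ℕ) : ℕ := c * (Nat.log 2 n + 1)

/-- The law of a sequence of independent uniformly random words of `w` bits. -/
noncomputable def randomWords (w : ℕ) : Measure (ℕ → Fin (2 ^ w)) :=
  Measure.infinitePi fun _ => (PMF.uniformOfFintype (Fin (2 ^ w))).toMeasure

/-! # A fully dynamic spanner with worst-case update time of order the square root of `n`

The algorithm draws no random words and maintains a spanner of stretch `3`, so that the bounds hold with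
certainty.  The nodes are divided into groups of size `q`, the square root of `n` rounded up.  There is a
list for every node `u` and every group, of the neighbours of `u` in the group, and a list for every pair
of nodes in the same group, of their common neighbours.  The output consists of the edges from the first
element of every list to the one or two nodes that the list belongs to.  An edge from `v` to `u` is
replaced by a path from `v` to the first neighbour `y` of `v` in the group of `u`, to the first common
neighbour `z` of `y` and `u`, and to `u`.  An update changes at most `2 * q + 2` lists, by one element
each. -/

/-! ## Lists with constant-time insertion and deletion -/

/-! A deterministic structure of stretch `3` satisfies all the bounds. The failure event is empty,
`log n ≥ 1` for `n ≥ 3` makes the logarithms in the time bound harmless, and `log (log n) ≥ log (log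
3) > 0` lets the constant absorb the double logarithm in the size bound.

Take groups of `q` consecutive nodes, with `n ≤ q * q`. Stretch (`Represents.exists_path`): for an
edge `uv` let `y` be the neighbour chosen for `v` in the group of `u`. If `y ≠ u`, then `v` itself
shows that `u` and `y`, two nodes of one group, have a common neighbour. Hence one, `z`, has been
chosen for this pair, and `v, y, z, u` is a path in the output. Size (`Represents.card_out_le`):
there are at most `n * q` choices of a node and a group, and at most `n * q` pairs within groups.
Each of these lists contributes at most two edges. Time (`keys_addEdge`): making `v` a neighbour of
`u` affects the list of `u` for the group of `v`, and the lists of the pairs `u, x` with `x` in the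
group of `u` and adjacent to `v`; then the same with `u` and `v` exchanged.

The rest verifies the program. The invariant `Represents` says that the arrays hold a set of pairs
(list, element) and that the output is the support of the multiset sum of the contributions of all
lists. `modify_spec` changes this set by one pair. Insertions and deletions are treated alike: `g`
is always the graph without the edge, and its set `keys` differs from that of the graph with the
edge by two disjoint sets `halfKeys`, which are added or removed pair by pair. No arithmetic wraps
around, since indices and counters stay below the word size (`Fits`). -/

/-- The first `c` entries of the array `l` enumerate the set `S` of numbers below `n` without repetition,
and `p` holds the position of every element. -/
structure ListRep (n c : ℕ) (l p : ℕ → ℕ) (S : Set ℕ) : Prop where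
  bound : ∀ w ∈ S, w < n
  pos_lt : ∀ w ∈ S, p w < c
  get_pos : ∀ w ∈ S, l (p w) = w
  mem : ∀ j < c, l j ∈ S
  pos_get : ∀ j < c, p (l j) = j

namespace ListRep

variable {n c : ℕ} {l p l' p' : ℕ → ℕ} {S : Set ℕ}

theorem injOn (h : ListRep n c l p S) : Set.InjOn l (Finset.range c : Set ℕ) := by
  intro i hi j hj hij
  simp only [Finset.coe_range, Set.mem_Iio] at hi hj
  rw [← h.pos_get i hi, hij, h.pos_get j hj]

theorem le (h : ListRep n c l p S) : c ≤ n := by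
  simpa using Finset.card_le_card_of_injOn (s := Finset.range c) (t := Finset.range n) l
    (fun j hj => by simpa using h.bound _ (h.mem j (by simpa using hj))) h.injOn

theorem lt (h : ListRep n c l p S) {w : ℕ} (hw : w < n) (hS : w ∉ S) : c < n := by
  have := Finset.card_le_card_of_injOn (s := Finset.range c) (t := (Finset.range n).erase w) l
    (fun j hj => by
      have := h.mem j (by simpa using hj)
      simp only [Finset.coe_erase, Finset.coe_range, Set.mem_sdiff, Set.mem_Iio,
        Set.mem_singleton_iff]
      exact ⟨h.bound _ this, fun h' => hS (h' ▸ this)⟩) h.injOn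
  rw [Finset.card_erase_of_mem (by simpa using hw)] at this
  simp at this
  omega

theorem congr (h : ListRep n c l p S) (hl : ∀ j < n, l' j = l j) (hp : ∀ j < n, p' j = p j) :
    ListRep n c l' p' S where
  bound := h.bound
  pos_lt w hw := by rw [hp w (h.bound w hw)]; exact h.pos_lt w hw
  get_pos w hw := by
    rw [hp w (h.bound w hw), hl _ ((h.pos_lt w hw).trans_le h.le), h.get_pos w hw]
  mem j hj := by rw [hl j (hj.trans_le h.le)]; exact h.mem j hj
  pos_get j hj := by
    rw [hl j (hj.trans_le h.le), hp _ (h.bound _ (h.mem j hj)), h.pos_get j hj]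

theorem insert (h : ListRep n c l p S) {w : ℕ} (hw : w < n) (hS : w ∉ S) :
    ListRep n (c + 1) (Function.update l c w) (Function.update p w c) (insert w S) where
  bound x hx := by
    rcases hx with rfl | hx
    · exact hw
    · exact h.bound x hx
  pos_lt x hx := by
    rcases eq_or_ne x w with rfl | hne
    · simp
    · have := h.pos_lt x (hx.resolve_left hne)
      simp only [Function.update_of_ne hne]; omega
  get_pos x hx := by
    rcases eq_or_ne x w with rfl | hne
    · simp
    · have := h.pos_lt x (hx.resolve_left hne)
      rw [Function.update_of_ne hne, Function.update_of_ne this.ne]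
      exact h.get_pos x (hx.resolve_left hne)
  mem j hj := by
    rcases eq_or_ne j c with rfl | hne
    · simp
    · rw [Function.update_of_ne hne]; exact Or.inr (h.mem j (by omega))
  pos_get j hj := by
    rcases eq_or_ne j c with rfl | hne
    · simp
    · have hm := h.mem j (by omega)
      rw [Function.update_of_ne hne, Function.update_of_ne (fun h1 : l j = w => hS (h1 ▸ hm))]
      exact h.pos_get j (by omega)

/-- The order of a list is irrelevant, so its last entry can fill the gap. If `w` is itself the last
entry, the two updates only touch cells that are no longer read. -/
theorem erase (h : ListRep n (c + 1) l p S) {w : ℕ} (hS : w ∈ S) :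
    ListRep n c (Function.update l (p w) (l c)) (Function.update p (l c) (p w)) (S \ {w}) where
  bound x hx := h.bound x hx.1
  pos_lt x hx := by
    have hp := h.pos_lt x hx.1
    rcases eq_or_ne x (l c) with rfl | hne
    · have hw := h.pos_lt w hS
      rw [Function.update_self]
      have : p w ≠ c := fun h' => hx.2 (by rw [← h', h.get_pos w hS]; rfl)
      omega
    · rw [Function.update_of_ne hne]
      have : p x ≠ c := fun h' => hne (by rw [← h', h.get_pos x hx.1])
      omega
  get_pos x hx := by
    rcases eq_or_ne x (l c) with rfl | hne
    · simp
    · rw [Function.update_of_ne hne, Function.update_of_ne, h.get_pos x hx.1]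
      intro h'
      exact hx.2 (by rw [Set.mem_singleton_iff, ← h.get_pos x hx.1, h', h.get_pos w hS])
  mem j hj := by
    rcases eq_or_ne j (p w) with rfl | hne
    · rw [Function.update_self]
      refine ⟨h.mem c (by omega), fun h' => ?_⟩
      have := h.pos_get c (by omega)
      rw [Set.mem_singleton_iff.1 h'] at this
      omega
    · rw [Function.update_of_ne hne]
      refine ⟨h.mem j (by omega), fun h' => hne ?_⟩
      rw [← Set.mem_singleton_iff.1 h', h.pos_get j (by omega)]
  pos_get j hj := by
    rcases eq_or_ne j (p w) with rfl | hne
    · simp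
    · rw [Function.update_of_ne hne, Function.update_of_ne, h.pos_get j (by omega)]
      intro h'
      have := h.pos_get j (by omega)
      rw [h', h.pos_get c (by omega)] at this
      omega

end ListRep

/-! ## Reference counts of the output edges -/

theorem flat_index_inj {n x y x' y' : ℕ} (hy : y < n) (hy' : y' < n) :
    x * n + y = x' * n + y' ↔ x = x' ∧ y = y' := by
  refine ⟨fun h => ?_, fun ⟨h, h'⟩ => by rw [h, h']⟩
  have hn : 0 < n := by omega
  have h1 := congrArg (· / n) h
  have h2 := congrArg (· % n) h
  simpa [Nat.add_div_of_dvd_right, Nat.div_eq_of_lt hy, Nat.div_eq_of_lt hy', hn,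
    Nat.mod_eq_of_lt hy, Nat.mod_eq_of_lt hy'] using And.intro h1 h2

/-- The array `rc` counts how often each pair of nodes occurs in the multiset `M`, and `out` holds the
edges whose end points occur as a pair in `M`. -/
structure CountRep (n : ℕ) (M : Multiset (ℕ × ℕ)) (rc : ℕ → ℕ) (out : Finset (Sym2 ℕ)) : Prop where
  bound : ∀ p ∈ M, p.1 < n ∧ p.2 < n
  count : ∀ x < n, ∀ y < n, rc (x * n + y) = M.count (x, y)
  mem_out : ∀ e, e ∈ out ↔ ∃ p ∈ M, e = s(p.1, p.2)

namespace CountRep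

variable {n : ℕ} {M : Multiset (ℕ × ℕ)} {rc : ℕ → ℕ} {out : Finset (Sym2 ℕ)}

theorem inc (h : CountRep n M rc out) {z y : ℕ} (hz : z < n) (hy : y < n) :
    CountRep n ((z, y) ::ₘ M) (Function.update rc (z * n + y) (rc (z * n + y) + 1))
      (insert s(z, y) out) where
  bound p hp := by
    rcases Multiset.mem_cons.1 hp with rfl | hp
    · exact ⟨hz, hy⟩
    · exact h.bound p hp
  count x' hx' y' hy' := by
    simp only [Function.update_apply, flat_index_inj hy' hy, Multiset.count_cons, Prod.mk.injEq]
    split_ifs with h'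
    · rw [h.count z hz y hy, h'.1, h'.2]
    · rw [h.count x' hx' y' hy', add_zero]
  mem_out e := by
    simp only [Finset.mem_insert, h.mem_out, Multiset.mem_cons, exists_eq_or_imp]

/-- The multiset records ordered pairs but the output unordered edges, so an edge must stay as long
as either orientation is left. This is why the test adds two counts, both read after the decrement.
-/
theorem dec {z y : ℕ} (h : CountRep n ((z, y) ::ₘ M) rc out) :
    CountRep n M (Function.update rc (z * n + y) (rc (z * n + y) - 1))
      (if Function.update rc (z * n + y) (rc (z * n + y) - 1) (z * n + y) +
          Function.update rc (z * n + y) (rc (z * n + y) - 1) (y * n + z) = 0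
        then out.erase s(z, y) else out) := by
  obtain ⟨hz, hy⟩ := h.bound (z, y) (by simp)
  have hc : ∀ x' < n, ∀ y' < n,
      Function.update rc (z * n + y) (rc (z * n + y) - 1) (x' * n + y') = M.count (x', y') := by
    intro x' hx' y' hy'
    have := h.count x' hx' y' hy'
    simp only [Multiset.count_cons, Prod.mk.injEq] at this
    simp only [Function.update_apply, flat_index_inj hy' hy]
    split_ifs with h'
    · obtain ⟨rfl, rfl⟩ := h'
      rw [this]; simp
    · rw [this, if_neg h', add_zero]
  refine ⟨fun p hp => h.bound p (Multiset.mem_cons_of_mem hp), hc, fun e => ?_⟩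
  rw [hc z hz y hy, hc y hy z hz]
  have hm := h.mem_out e
  simp only [Multiset.mem_cons, exists_eq_or_imp] at hm
  split_ifs with h0
  · rw [Nat.add_eq_zero_iff, Multiset.count_eq_zero, Multiset.count_eq_zero] at h0
    rw [Finset.mem_erase, hm]
    constructor
    · rintro ⟨h1, h2 | h2⟩
      · exact absurd h2 h1
      · exact h2
    · rintro ⟨p, hp, rfl⟩
      refine ⟨fun h' => ?_, Or.inr ⟨p, hp, rfl⟩⟩
      rcases Sym2.eq_iff.1 h' with ⟨h1, h2⟩ | ⟨h1, h2⟩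
      · exact h0.1 (by rw [← h1, ← h2]; exact hp)
      · exact h0.2 (by rw [← h1, ← h2]; exact hp)
  · rw [hm]
    refine ⟨fun h' => h'.elim (fun h1 => ?_) id, Or.inr⟩
    by_cases hzy : (z, y) ∈ M
    · exact ⟨_, hzy, h1⟩
    · have : (y, z) ∈ M := by
        by_contra h2
        rw [Multiset.count_eq_zero_of_notMem hzy, Multiset.count_eq_zero_of_notMem h2] at h0
        exact h0 rfl
      exact ⟨_, this, h1.trans Sym2.eq_swap⟩

end CountRep

/-! ## The family of lists -/

/-- The contribution of the list number `κ` to the output: the first element of the list is joined to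
the two nodes encoded by `κ`. -/
def contrib (n : ℕ) (m : ℕ → ℕ → ℕ) (κ : ℕ) : Multiset (ℕ × ℕ) :=
  -- For a list that belongs to a single node the two encoded nodes coincide, and its pair is
  -- counted twice.
  if m 1 κ = 0 then 0 else (κ / n / n, m 2 (κ * n)) ::ₘ {(κ / n % n, m 2 (κ * n))}

theorem card_contrib_le (n : ℕ) (m : ℕ → ℕ → ℕ) (κ : ℕ) : (contrib n m κ).card ≤ 2 := by
  unfold contrib
  split_ifs <;> simp

theorem card_sum_contrib_le (n : ℕ) (m : ℕ → ℕ → ℕ) (X : Finset ℕ) :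
    (∑ κ ∈ X, contrib n m κ).card ≤ 2 * X.card := by
  rw [Multiset.card_sum, mul_comm, ← smul_eq_mul]
  exact Finset.sum_le_card_nsmul _ _ _ fun κ _ => card_contrib_le n m κ

/-- The lists number `κ < n ^ 3` hold the sets `{w | (κ, w) ∈ T}`. -/
def ListsRep (n : ℕ) (T : Set (ℕ × ℕ)) (m : ℕ → ℕ → ℕ) : Prop :=
  ∀ κ < n ^ 3, ListRep n (m 1 κ) (fun j => m 2 (κ * n + j)) (fun w => m 3 (κ * n + w))
    {w | (κ, w) ∈ T}

/-- The lists hold the set `T`, and the output consists of the contributions of all lists. -/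
structure Represents (n : ℕ) (T : Set (ℕ × ℕ)) (s : MState) : Prop where
  lists : ListsRep n T s.mem
  counts : CountRep n (∑ κ ∈ Finset.range (n ^ 3), contrib n s.mem κ) (s.mem 4) s.out

/-- Insert or delete a set of pairs. -/
def applyFlag (f : ℕ) (T D : Set (ℕ × ℕ)) : Set (ℕ × ℕ) := if f = 0 then T \ D else T ∪ D

/-- The pairs to be inserted are new, respectively the pairs to be deleted are present. -/
def FlagOk (f : ℕ) (T D : Set (ℕ × ℕ)) : Prop := if f = 0 then D ⊆ T else Disjoint T D

theorem applyFlag_union (f : ℕ) (T D E : Set (ℕ × ℕ)) :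
    applyFlag f (applyFlag f T D) E = applyFlag f T (D ∪ E) := by
  unfold applyFlag
  split_ifs
  · rw [Set.sdiff_sdiff]
  · rw [Set.union_assoc]

theorem FlagOk.left {f : ℕ} {T D E : Set (ℕ × ℕ)} (h : FlagOk f T (D ∪ E)) : FlagOk f T D := by
  unfold FlagOk at *
  split_ifs at * with hf
  · exact Set.subset_union_left.trans h
  · exact (Set.disjoint_union_right.1 h).1

/-- Changes can be made in succession: by disjointness the first does not spoil the precondition of
the second. -/
theorem FlagOk.right {f : ℕ} {T D E : Set (ℕ × ℕ)} (h : FlagOk f T (D ∪ E)) (hd : Disjoint D E) :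
    FlagOk f (applyFlag f T D) E := by
  unfold FlagOk applyFlag at *
  split_ifs at * with hf
  · exact fun p hp => ⟨h (Or.inr hp), fun hp' => Set.disjoint_left.1 hd hp' hp⟩
  · exact Set.disjoint_union_left.2 ⟨(Set.disjoint_union_right.1 h).2, hd⟩

/-! ## Loop-free programs -/

/-- The final state of a loop-free program that draws no random words. -/
def Cmd.run (W : ℕ) : Cmd → MState → MState
  | .assign r e, s => s.setReg r (e.eval W s)
  | .store a i e, s => s.setMem a (i.eval W s) (e.eval W s)
  | .report e₁ e₂, s => { s with out := insert s(e₁.eval W s, e₂.eval W s) s.out }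
  | .retract e₁ e₂, s => { s with out := s.out.erase s(e₁.eval W s, e₂.eval W s) }
  | .seq p q, s => q.run W (p.run W s)
  | .ite b p q, s => if b.eval W s = 0 then q.run W s else p.run W s
  -- This is right for `skip`; for `rand` and `loop` it is a default value, excluded by
  -- `Cmd.Simple`.
  | _, s => s

/-- A bound for the running time of a loop-free program. -/
def Cmd.bound : Cmd → ℕ
  | .skip => 1
  | .assign _ e => e.cost + 1
  | .store _ i e => i.cost + e.cost + 1
  | .rand _ => 1
  | .report e₁ e₂ => e₁.cost + e₂.cost + 1
  | .retract e₁ e₂ => e₁.cost + e₂.cost + 1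
  | .seq p q => p.bound + q.bound
  | .ite b p q => b.cost + 1 + (p.bound + q.bound)
  | .loop _ _ => 0

/-- A program that neither loops nor draws random words. -/
def Cmd.Simple : Cmd → Prop
  | .seq p q => p.Simple ∧ q.Simple
  | .ite _ p q => p.Simple ∧ q.Simple
  | .loop _ _ => False
  | .rand _ => False
  | _ => True

/-- The program `p` leads from `s` to `s'` in at most `b` units of time. -/
def Reaches (W : ℕ) (ω : ℕ → ℕ) (p : Cmd) (s s' : MState) (b : ℕ) : Prop :=
  ∃ k ≤ b, Exec W ω p s s' k

theorem Reaches.seq {W : ℕ} {ω : ℕ → ℕ} {p q : Cmd} {s s' s'' : MState} {b b' : ℕ}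
    (h : Reaches W ω p s s' b) (h' : Reaches W ω q s' s'' b') :
    Reaches W ω (.seq p q) s s'' (b + b') := by
  obtain ⟨k, hk, h⟩ := h
  obtain ⟨l, hl, h'⟩ := h'
  exact ⟨k + l, by omega, h.seq h'⟩

theorem Cmd.Simple.reaches {W : ℕ} {ω : ℕ → ℕ} {p : Cmd} (hp : p.Simple) (s : MState) :
    Reaches W ω p s (p.run W s) p.bound := by
  induction p generalizing s with
  | skip => exact ⟨_, le_rfl, .skip s⟩
  | assign r e => exact ⟨_, le_rfl, .assign s r e⟩
  | store a i e => exact ⟨_, le_rfl, .store s a i e⟩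
  | rand r => exact hp.elim
  | report e₁ e₂ => exact ⟨_, le_rfl, .report s e₁ e₂⟩
  | retract e₁ e₂ => exact ⟨_, le_rfl, .retract s e₁ e₂⟩
  | seq p q ihp ihq => exact (ihp hp.1 s).seq (ihq hp.2 _)
  | ite b p q ihp ihq =>
    by_cases hb : b.eval W s = 0
    · obtain ⟨k, hk, h⟩ := ihq hp.2 s
      simp only [Cmd.run, hb, if_true]
      exact ⟨_, by simp only [Cmd.bound]; omega, .ite_false hb h⟩
    · obtain ⟨k, hk, h⟩ := ihp hp.1 s
      simp only [Cmd.run, hb, if_false]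
      exact ⟨_, by simp only [Cmd.bound]; omega, .ite_true hb h⟩
  | loop b p => exact hp.elim

/-- A loop that performs `N` steps, each within time `b`. -/
theorem Reaches.loop {W : ℕ} {ω : ℕ → ℕ} {e : Expr} {p : Cmd} {b : ℕ} (P : ℕ → MState → Prop)
    (N : ℕ) (hN : ∀ s, P N s → e.eval W s = 0)
    (hstep : ∀ j < N, ∀ s, P j s → e.eval W s ≠ 0 ∧ ∃ s', Reaches W ω p s s' b ∧ P (j + 1) s')
    (j : ℕ) (hj : j ≤ N) (s : MState) (hs : P j s) :
    ∃ s', Reaches W ω (.loop e p) s s' ((N - j) * (e.cost + 1 + b) + (e.cost + 1)) ∧ P N s' := by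
  induction hd : N - j generalizing j s with
  | zero =>
    obtain rfl : j = N := by omega
    exact ⟨s, ⟨_, by omega, .loop_done (hN s hs)⟩, hs⟩
  | succ d ih =>
    obtain ⟨he, s', ⟨k, hk, hp⟩, hs'⟩ := hstep j (by omega) s hs
    obtain ⟨s'', ⟨l, hl, hp'⟩, hs''⟩ := ih (j + 1) (by omega) s' hs' (by omega)
    refine ⟨s'', ⟨_, ?_, .loop_step he hp hp'⟩, hs''⟩
    rw [Nat.succ_mul]
    omega

/-! ## The program

Registers: `0` the number `n` of nodes, `1`, `2`, `3` the update, `4` the size of the groups of nodes,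
`5`, `6` the end points of the edge, `7` a loop counter, `8` a node, `9` the number of a list.
Arrays: `0` adjacency matrix, `1` lengths of the lists, `2` their entries, `3` the positions of the
elements in the lists, `4` the reference counts. -/

namespace Prog

instance : Add Expr := ⟨.op .add⟩
instance : Sub Expr := ⟨.op .sub⟩
instance : Mul Expr := ⟨.op .mul⟩
instance : Div Expr := ⟨.op .div⟩
instance : Mod Expr := ⟨.op .mod⟩

/-- The first node encoded by the number of a list. -/
def keyA : Expr := .reg 9 / .reg 0 / .reg 0

/-- The second node encoded by the number of a list. -/
def keyB : Expr := .reg 9 / .reg 0 % .reg 0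

/-- The first element of the list. -/
def head : Expr := .load 2 (.reg 9 * .reg 0)

/-- Add the edge from `z` to the first element of the list to the output. -/
def inc (z : Expr) : Cmd :=
  .seq (.store 4 (z * .reg 0 + head) (.load 4 (z * .reg 0 + head) + .const 1)) (.report z head)

/-- Give up one reference to the edge from `z` to the first element of the list. -/
def dec (z : Expr) : Cmd :=
  .seq (.store 4 (z * .reg 0 + head) (.load 4 (z * .reg 0 + head) - .const 1))
    (.ite (.load 4 (z * .reg 0 + head) + .load 4 (head * .reg 0 + z)) .skip (.retract z head))

/-- Remove the contribution of the list from the output. -/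
def unlink : Cmd := .ite (.load 1 (.reg 9)) (.seq (dec keyA) (dec keyB)) .skip

/-- Add the contribution of the list to the output. -/
def link : Cmd := .ite (.load 1 (.reg 9)) (.seq (inc keyB) (inc keyA)) .skip

/-- Append the node in register `6` to the list. -/
def listInsert : Cmd :=
  .seq (.store 2 (.reg 9 * .reg 0 + .load 1 (.reg 9)) (.reg 6))
    (.seq (.store 3 (.reg 9 * .reg 0 + .reg 6) (.load 1 (.reg 9)))
      (.store 1 (.reg 9) (.load 1 (.reg 9) + .const 1)))

/-- Delete the node in register `6` from the list: the last entry takes its place. -/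
def listErase : Cmd :=
  .seq (.store 1 (.reg 9) (.load 1 (.reg 9) - .const 1))
    (.seq (.store 2 (.reg 9 * .reg 0 + .load 3 (.reg 9 * .reg 0 + .reg 6))
        (.load 2 (.reg 9 * .reg 0 + .load 1 (.reg 9))))
      (.store 3 (.reg 9 * .reg 0 + .load 2 (.reg 9 * .reg 0 + .load 1 (.reg 9)))
        (.load 3 (.reg 9 * .reg 0 + .reg 6))))

/-- Insert the node in register `6` into the list, or delete it, and adjust the output. -/
def modify : Cmd := .seq unlink (.seq (.ite (.reg 1) listInsert listErase) link)

/-- The loop body: modify the list of common neighbours of the nodes in registers `5` and `8`. -/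
def body : Cmd :=
  .seq (.assign 8 (.reg 5 / .reg 4 * .reg 4 + .reg 7))
    (.seq
      (.ite (.load 0 (.reg 8 * .reg 0 + .reg 6))
        (.seq
          (.ite (.op .lt (.reg 5) (.reg 8))
            (.assign 9 ((.reg 5 * .reg 0 + .reg 8) * .reg 0))
            (.assign 9 ((.reg 8 * .reg 0 + .reg 5) * .reg 0)))
          modify)
        .skip)
      (.assign 7 (.reg 7 + .const 1)))

/-- Modify the list of neighbours of the node in register `5`. -/
def lead : Cmd :=
  .seq (.assign 9 ((.reg 5 * .reg 0 + .reg 5) * .reg 0 + .reg 6 / .reg 4))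
    (.seq modify (.assign 7 (.const 0)))

/-- The loop condition. -/
def cond : Expr := .op .lt (.reg 7) (.reg 4)

/-- Process the oriented edge whose end points are in registers `5` and `6`. -/
def half : Cmd := .seq lead (.loop cond body)

/-- Store the value of an expression into the two entries of the adjacency matrix for the edge. -/
def setAdj (e : Expr) : Cmd :=
  .seq (.store 0 (.reg 2 * .reg 0 + .reg 3) e) (.store 0 (.reg 3 * .reg 0 + .reg 2) e)

/-- Clear the adjacency and copy the end points. -/
def before : Cmd := .seq (setAdj (.const 0)) (.seq (.assign 5 (.reg 2)) (.assign 6 (.reg 3)))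

/-- Exchange the end points. -/
def swap : Cmd := .seq (.assign 5 (.reg 3)) (.assign 6 (.reg 2))

/-- The program run after every update. -/
def update : Cmd := .seq before (.seq half (.seq swap (.seq half (setAdj (.reg 1)))))

/-- The test whether the group size is still too small. -/
def initCond : Expr := .op .lt (.reg 4 * .reg 4) (.reg 0)

/-- One more node per group. -/
def initBody : Cmd := .assign 4 (.reg 4 + .const 1)

/-- The initialization: compute the size of the groups. -/
def init : Cmd := .loop initCond initBody

/-- The spanner algorithm. -/
def spanner : DynAlgorithm := ⟨init, update⟩

end Prog

/-! ### Evaluation rules for expressions and states. -/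

section Semantics

variable {W : ℕ} {s : MState}

@[simp] theorem Expr.eval_add (e f : Expr) : (e + f).eval W s = (e.eval W s + f.eval W s) % W := rfl
@[simp] theorem Expr.eval_sub (e f : Expr) : (e - f).eval W s = e.eval W s - f.eval W s := rfl
@[simp] theorem Expr.eval_mul (e f : Expr) : (e * f).eval W s = (e.eval W s * f.eval W s) % W := rfl
@[simp] theorem Expr.eval_div (e f : Expr) : (e / f).eval W s = e.eval W s / f.eval W s := rfl
@[simp] theorem Expr.eval_mod (e f : Expr) : (e % f).eval W s = e.eval W s % f.eval W s := rfl
@[simp] theorem Expr.eval_reg (r : ℕ) : (Expr.reg r).eval W s = s.regs r := rfl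
@[simp] theorem Expr.eval_load (a : ℕ) (i : Expr) :
    (Expr.load a i).eval W s = s.mem a (i.eval W s) := rfl
@[simp] theorem Expr.eval_const (k : ℕ) : (Expr.const k).eval W s = k % W := rfl
@[simp] theorem Expr.eval_lt (e f : Expr) : (Expr.op .lt e f).eval W s =
    (if e.eval W s < f.eval W s then 1 else 0) % W := rfl

@[simp] theorem MState.regs_setMem (a i x : ℕ) : (s.setMem a i x).regs = s.regs := rfl
@[simp] theorem MState.out_setMem (a i x : ℕ) : (s.setMem a i x).out = s.out := rfl
@[simp] theorem MState.mem_setMem_self (a i x : ℕ) :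
    (s.setMem a i x).mem a = Function.update (s.mem a) i x := by simp [MState.setMem]
theorem MState.mem_setMem_of_ne {a b : ℕ} (h : b ≠ a) (i x : ℕ) :
    (s.setMem a i x).mem b = s.mem b := by simp [MState.setMem, h]
@[simp] theorem MState.mem_setReg (r x : ℕ) : (s.setReg r x).mem = s.mem := rfl
@[simp] theorem MState.out_setReg (r x : ℕ) : (s.setReg r x).out = s.out := rfl
@[simp] theorem MState.regs_setReg (r x : ℕ) :
    (s.setReg r x).regs = Function.update s.regs r x := rfl

end Semantics

/-! ### Word size, and correctness of the reference counting. -/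

namespace Prog

variable {W n : ℕ} {s : MState}

/-- Registers and arrays, except for the arrays in `A`, are the same in both states. -/
structure SameBut (A : Set ℕ) (s s' : MState) : Prop where
  regs : s'.regs = s.regs
  mem : ∀ a ∉ A, s'.mem a = s.mem a

theorem SameBut.trans {A : Set ℕ} {s s' s'' : MState} (h : SameBut A s s') (h' : SameBut A s' s'') :
    SameBut A s s'' := ⟨h'.regs.trans h.regs, fun a ha => (h'.mem a ha).trans (h.mem a ha)⟩

theorem SameBut.mono {A B : Set ℕ} {s s' : MState} (h : SameBut A s s') (hAB : A ⊆ B) :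
    SameBut B s s' := ⟨h.regs, fun a ha => h.mem a fun h' => ha (hAB h')⟩

/-- The program counts as intended below the word size. -/
structure Fits (W n : ℕ) : Prop where
  pos : 3 ≤ n
  fits : 9 * n ^ 4 ≤ W

theorem Fits.one_lt (h : Fits W n) : 1 < W := by
  have h1 := h.fits
  have : 1 ≤ n ^ 4 := Nat.one_le_pow _ _ (by have := h.pos; omega)
  omega

theorem Fits.cube (h : Fits W n) : 27 * n ^ 3 ≤ W := by
  have h1 := h.fits
  have : 3 * n ^ 3 ≤ n ^ 4 := by rw [pow_succ' n 3]; exact Nat.mul_le_mul_right _ h.pos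
  omega

theorem Fits.square (h : Fits W n) : 81 * n ^ 2 ≤ W := by
  have h1 := h.cube
  have : 3 * n ^ 2 ≤ n ^ 3 := by rw [pow_succ' n 2]; exact Nat.mul_le_mul_right _ h.pos
  omega

theorem flat_lt {n K x y : ℕ} (hx : x < K) (hy : y < n) : x * n + y < K * n := by
  calc x * n + y < x * n + n := by omega
    _ = (x + 1) * n := by ring
    _ ≤ K * n := Nat.mul_le_mul_right _ hx

theorem Fits.cell (h : Fits W n) {x y : ℕ} (hx : x < n) (hy : y < n) : x * n + y < W := by
  have h1 := h.square
  have := flat_lt hx hy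
  rw [pow_two] at h1
  omega

theorem Fits.entry (h : Fits W n) {κ y : ℕ} (hx : κ < n ^ 3) (hy : y < n) : κ * n + y < W := by
  have h1 := h.fits
  have := flat_lt hx hy
  rw [pow_succ n 3] at h1
  omega

/-- The node expression is evaluated again after the counter has been written, so its value must not
depend on array `4`. The bound on `M.card` keeps the incremented counter below the word size. -/
theorem inc_spec (hW : Fits W n) {M : Multiset (ℕ × ℕ)} {z : Expr} {x : ℕ} (hn : s.regs 0 = n)
    (hz : ∀ i v, z.eval W (s.setMem 4 i v) = x) (hz0 : z.eval W s = x) (hx : x < n)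
    (hκ : s.regs 9 < n ^ 3) (hh : s.mem 2 (s.regs 9 * n) < n) (hM : M.card ≤ 2 * n ^ 3)
    (h : CountRep n M (s.mem 4) s.out) :
    SameBut {4} s ((inc z).run W s) ∧
      CountRep n ((x, s.mem 2 (s.regs 9 * n)) ::ₘ M) (((inc z).run W s).mem 4)
        ((inc z).run W s).out := by
  have h1 := hW.cell hx hh
  have h2 := hW.entry hκ (show 0 < n by omega)
  rw [add_zero] at h2
  have h3 : x * n < W := by omega
  have h4 : s.mem 4 (x * n + s.mem 2 (s.regs 9 * n)) + 1 < W := by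
    rw [h.count _ hx _ hh]
    have := Multiset.count_le_card (x, s.mem 2 (s.regs 9 * n)) M
    have := hW.cube
    have : 1 ≤ n ^ 3 := Nat.one_le_pow _ _ (by omega)
    omega
  have h5 := hW.one_lt
  constructor
  · refine ⟨by simp [inc, Cmd.run], fun a ha => ?_⟩
    simp only [Set.mem_singleton_iff] at ha
    simp [inc, Cmd.run, MState.mem_setMem_of_ne ha]
  · have := h.inc hx hh
    simpa [inc, Cmd.run, head, hn, hz, hz0, Nat.mod_eq_of_lt h1, Nat.mod_eq_of_lt h2,
      Nat.mod_eq_of_lt h3, Nat.mod_eq_of_lt h4, Nat.mod_eq_of_lt h5,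
      MState.mem_setMem_of_ne] using this

theorem dec_spec (hW : Fits W n) {M : Multiset (ℕ × ℕ)} {z : Expr} {x : ℕ} (hn : s.regs 0 = n)
    (hz : ∀ i v, z.eval W (s.setMem 4 i v) = x) (hz0 : z.eval W s = x)
    (hκ : s.regs 9 < n ^ 3) (hM : M.card ≤ 2 * n ^ 3)
    (h : CountRep n ((x, s.mem 2 (s.regs 9 * n)) ::ₘ M) (s.mem 4) s.out) :
    SameBut {4} s ((dec z).run W s) ∧
      CountRep n M (((dec z).run W s).mem 4) ((dec z).run W s).out := by
  obtain ⟨hx, hh⟩ := h.bound (x, s.mem 2 (s.regs 9 * n)) (by simp)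
  simp only at hx hh
  have h1 := hW.cell hx hh
  have h1' := hW.cell hh hx
  have h2 := hW.entry hκ (show 0 < n by omega)
  rw [add_zero] at h2
  have h3 : x * n < W := by omega
  have h3' : s.mem 2 (s.regs 9 * n) * n < W := by omega
  have h5 := hW.one_lt
  have h6 := h.dec
  set y := s.mem 2 (s.regs 9 * n) with hy
  have h4 : Function.update (s.mem 4) (x * n + y) (s.mem 4 (x * n + y) - 1) (x * n + y) +
      Function.update (s.mem 4) (x * n + y) (s.mem 4 (x * n + y) - 1) (y * n + x) < W := by
    rw [h6.count _ hx _ hh, h6.count _ hh _ hx]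
    have := Multiset.count_le_card (x, y) M
    have := Multiset.count_le_card (y, x) M
    have := hW.cube
    have : 1 ≤ n ^ 3 := Nat.one_le_pow _ _ (by omega)
    omega
  have e2 : ∀ i v, head.eval W (s.setMem 4 i v) = y := fun i v => by
    simp [head, hn, Nat.mod_eq_of_lt h2, MState.mem_setMem_of_ne, ← hy]
  have e1 : head.eval W s = y := by
    simp [head, hn, Nat.mod_eq_of_lt h2, ← hy]
  have e3 : (dec z).run W s = if Function.update (s.mem 4) (x * n + y)
      (s.mem 4 (x * n + y) - 1) (x * n + y) + Function.update (s.mem 4) (x * n + y)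
      (s.mem 4 (x * n + y) - 1) (y * n + x) = 0 then
        { s.setMem 4 (x * n + y) (s.mem 4 (x * n + y) - 1) with out := s.out.erase s(x, y) }
      else s.setMem 4 (x * n + y) (s.mem 4 (x * n + y) - 1) := by
    -- The program tests the sum modulo `W`; this puts the condition into the same form.
    rw [← Nat.mod_eq_of_lt h4]
    simp only [dec, Cmd.run, Expr.eval_add, Expr.eval_mul, Expr.eval_sub, Expr.eval_reg,
      Expr.eval_load, Expr.eval_const, hz, hz0, e1, e2, hn, Nat.mod_eq_of_lt h1,
      Nat.mod_eq_of_lt h1', Nat.mod_eq_of_lt h3, Nat.mod_eq_of_lt h3', Nat.mod_eq_of_lt h5,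
      MState.regs_setMem, MState.mem_setMem_self, MState.out_setMem]
  refine ⟨⟨?_, fun a ha => ?_⟩, ?_⟩
  · rw [e3]
    split_ifs <;> simp
  · rw [e3]
    simp only [Set.mem_singleton_iff] at ha
    split_ifs <;> simp [MState.mem_setMem_of_ne ha]
  · rw [e3]
    split_ifs at h6 ⊢ <;> simpa using h6

end Prog

/-- The lists are disjoint rows of flat arrays, so only the row that is changed has to be examined.
-/
theorem ListsRep.replace {n κ : ℕ} {T T' : Set (ℕ × ℕ)} {m m' : ℕ → ℕ → ℕ} (h : ListsRep n T m)
    (h1 : ∀ κ' ≠ κ, m' 1 κ' = m 1 κ') (h2 : ∀ κ' ≠ κ, ∀ j < n, m' 2 (κ' * n + j) = m 2 (κ' * n + j))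
    (h3 : ∀ κ' ≠ κ, ∀ j < n, m' 3 (κ' * n + j) = m 3 (κ' * n + j))
    (hT : ∀ κ' ≠ κ, ∀ w, (κ', w) ∈ T' ↔ (κ', w) ∈ T)
    (hκ : ListRep n (m' 1 κ) (fun j => m' 2 (κ * n + j)) (fun w => m' 3 (κ * n + w))
      {w | (κ, w) ∈ T'}) : ListsRep n T' m' := by
  intro κ' hκ'
  rcases eq_or_ne κ' κ with rfl | hne
  · exact hκ
  · have : {w | (κ', w) ∈ T'} = {w | (κ', w) ∈ T} := Set.ext (hT κ' hne)
    rw [this, h1 κ' hne]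
    exact (h κ' hκ').congr (h2 κ' hne) (h3 κ' hne)

theorem contrib_congr {n κ : ℕ} {m m' : ℕ → ℕ → ℕ} (h1 : m' 1 κ = m 1 κ)
    (h2 : m' 2 (κ * n) = m 2 (κ * n)) : contrib n m' κ = contrib n m κ := by
  simp only [contrib, h1, h2]

theorem update_row {n κ i j x : ℕ} (a : ℕ → ℕ) :
    Function.update a (κ * n + i) x (κ * n + j) = Function.update (fun j => a (κ * n + j)) i x j := by
  simp [Function.update_apply]

theorem update_other_row {n κ κ' i j x : ℕ} (a : ℕ → ℕ) (hne : κ' ≠ κ) (hi : i < n) (hj : j < n) :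
    Function.update a (κ * n + i) x (κ' * n + j) = a (κ' * n + j) := by
  simp [flat_index_inj hj hi, hne]

/-! ### Correctness of the change of a single list. -/

namespace Prog

variable {W n : ℕ} {s : MState}

theorem unlink_spec (hW : Fits W n) {M : Multiset (ℕ × ℕ)} (hn : s.regs 0 = n)
    (hκ : s.regs 9 < n ^ 3) (hM : M.card + 2 ≤ 2 * n ^ 3)
    (h : CountRep n (contrib n s.mem (s.regs 9) + M) (s.mem 4) s.out) :
    SameBut {4} s (unlink.run W s) ∧ CountRep n M ((unlink.run W s).mem 4) (unlink.run W s).out := by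
  by_cases h0 : s.mem 1 (s.regs 9) = 0
  · simp only [contrib, h0, if_true, zero_add] at h
    simpa [unlink, Cmd.run, h0] using ⟨⟨rfl, fun _ _ => rfl⟩, h⟩
  · simp only [contrib, h0, if_false] at h
    simp only [unlink, Cmd.run, Expr.eval_load, Expr.eval_reg, h0, if_false]
    rw [Multiset.cons_add] at h
    obtain ⟨hs, h'⟩ := dec_spec (z := keyA) hW hn (fun i v => by simp [keyA, hn]) (by simp [keyA, hn])
      hκ (by rw [Multiset.singleton_add, Multiset.card_cons]; omega) h
    set s' := (dec keyA).run W s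
    have e9 : s'.regs = s.regs := hs.regs
    have e2 : s'.mem 2 = s.mem 2 := hs.mem 2 (by simp)
    obtain ⟨hs', h''⟩ := dec_spec (s := s') (M := M) (z := keyB) (x := s.regs 9 / n % n) hW
      (by rw [e9, hn]) (fun i v => by simp [keyB, e9, hn]) (by simp [keyB, e9, hn])
      (by rw [e9]; exact hκ) (by omega)
      (by rw [e9, e2]; rwa [Multiset.singleton_add] at h')
    exact ⟨hs.trans hs', h''⟩

/-- The second node comes first here, so that prepending the two pairs yields the multiset in the
order used by `contrib`. -/
theorem link_spec (hW : Fits W n) {M : Multiset (ℕ × ℕ)} (hn : s.regs 0 = n)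
    (hκ : s.regs 9 < n ^ 3) (hM : M.card + 2 ≤ 2 * n ^ 3)
    (hh : s.mem 1 (s.regs 9) ≠ 0 → s.mem 2 (s.regs 9 * n) < n)
    (h : CountRep n M (s.mem 4) s.out) :
    SameBut {4} s (link.run W s) ∧
      CountRep n (contrib n s.mem (s.regs 9) + M) ((link.run W s).mem 4) (link.run W s).out := by
  by_cases h0 : s.mem 1 (s.regs 9) = 0
  · simp only [contrib, h0, if_true, zero_add]
    simpa [link, Cmd.run, h0] using ⟨⟨rfl, fun _ _ => rfl⟩, h⟩
  · simp only [contrib, h0, if_false]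
    simp only [link, Cmd.run, Expr.eval_load, Expr.eval_reg, h0, if_false]
    have hn0 : 0 < n := by have := hW.pos; omega
    have hA : s.regs 9 / n / n < n := by
      rw [Nat.div_div_eq_div_mul, Nat.div_lt_iff_lt_mul (by positivity)]
      linarith [hκ, show n ^ 3 = n * (n * n) by ring]
    obtain ⟨hs, h'⟩ := inc_spec (z := keyB) (x := s.regs 9 / n % n) hW hn
      (fun i v => by simp [keyB, hn]) (by simp [keyB, hn]) (Nat.mod_lt _ hn0)
      hκ (hh h0) (by omega) h
    set s' := (inc keyB).run W s
    have e9 : s'.regs = s.regs := hs.regs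
    have e2 : s'.mem 2 = s.mem 2 := hs.mem 2 (by simp)
    obtain ⟨hs', h''⟩ := inc_spec (s := s') (z := keyA) (x := s.regs 9 / n / n) hW
      (by rw [e9, hn]) (fun i v => by simp [keyA, e9, hn]) (by simp [keyA, e9, hn]) hA
      (by rw [e9]; exact hκ) (by rw [e9, e2]; exact hh h0)
      (by rw [Multiset.card_cons]; omega) h'
    refine ⟨hs.trans hs', ?_⟩
    rw [Multiset.cons_add, Multiset.singleton_add]
    rwa [e9, e2] at h''

theorem listInsert_spec (hW : Fits W n) {T : Set (ℕ × ℕ)} (hn : s.regs 0 = n)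
    (hκ : s.regs 9 < n ^ 3) (hw : s.regs 6 < n) (hT : (s.regs 9, s.regs 6) ∉ T)
    (h : ListsRep n T s.mem) :
    SameBut {1, 2, 3} s (listInsert.run W s) ∧ (listInsert.run W s).out = s.out ∧
      (∀ κ' ≠ s.regs 9, contrib n (listInsert.run W s).mem κ' = contrib n s.mem κ') ∧
      ListsRep n (T ∪ {(s.regs 9, s.regs 6)}) (listInsert.run W s).mem := by
  have hl := h _ hκ
  set κ := s.regs 9 with hκ'
  set w := s.regs 6 with hw'
  have hc : s.mem 1 κ < n := hl.lt hw hT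
  have hl' := hl.insert hw hT
  set c := s.mem 1 κ with hc'
  have b1 := hW.entry hκ hc
  have b2 := hW.entry hκ hw
  have b3 : κ * n < W := by omega
  have b4 := hW.one_lt
  have b5 : c + 1 < W := by
    have := hW.cell hw hc
    have := hW.square
    have : n ≤ n ^ 2 := Nat.le_self_pow (by omega) n
    omega
  have e1 : (listInsert.run W s).mem 1 = Function.update (s.mem 1) κ (c + 1) := by
    simp [listInsert, Cmd.run, hn, ← hκ', ← hw', ← hc', Nat.mod_eq_of_lt b1, Nat.mod_eq_of_lt b2,
      Nat.mod_eq_of_lt b3, Nat.mod_eq_of_lt b4, Nat.mod_eq_of_lt b5, MState.mem_setMem_of_ne]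
  have e2 : (listInsert.run W s).mem 2 = Function.update (s.mem 2) (κ * n + c) w := by
    simp [listInsert, Cmd.run, hn, ← hκ', ← hw', ← hc', Nat.mod_eq_of_lt b1,
      Nat.mod_eq_of_lt b3, MState.mem_setMem_of_ne]
  have e3 : (listInsert.run W s).mem 3 = Function.update (s.mem 3) (κ * n + w) c := by
    simp [listInsert, Cmd.run, hn, ← hκ', ← hw', ← hc', Nat.mod_eq_of_lt b2,
      Nat.mod_eq_of_lt b3, MState.mem_setMem_of_ne]
  refine ⟨⟨by simp [listInsert, Cmd.run], fun a ha => ?_⟩, by simp [listInsert, Cmd.run],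
    fun κ' hne => contrib_congr ?_ ?_, h.replace (κ := κ) ?_ ?_ ?_ ?_ ?_⟩
  · simp only [Set.mem_insert_iff, Set.mem_singleton_iff, not_or] at ha
    simp [listInsert, Cmd.run, MState.mem_setMem_of_ne, ha.1, ha.2.1, ha.2.2]
  · rw [e1, Function.update_of_ne hne]
  · rw [e2]
    simpa using update_other_row (s.mem 2) (x := w) hne hc (show 0 < n by omega)
  · intro κ' hne
    rw [e1, Function.update_of_ne hne]
  · intro κ' hne j hj
    rw [e2, update_other_row _ hne hc hj]
  · intro κ' hne j hj
    rw [e3, update_other_row _ hne hw hj]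
  · intro κ' hne x
    simp [hne]
  · rw [e1, e2, e3, Function.update_self]
    simp only [update_row]
    convert hl' using 1
    ext x
    simp

theorem listErase_spec (hW : Fits W n) {T : Set (ℕ × ℕ)} (hn : s.regs 0 = n)
    (hκ : s.regs 9 < n ^ 3) (hT : (s.regs 9, s.regs 6) ∈ T)
    (h : ListsRep n T s.mem) :
    SameBut {1, 2, 3} s (listErase.run W s) ∧ (listErase.run W s).out = s.out ∧
      (∀ κ' ≠ s.regs 9, contrib n (listErase.run W s).mem κ' = contrib n s.mem κ') ∧
      ListsRep n (T \ {(s.regs 9, s.regs 6)}) (listErase.run W s).mem := by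
  have hl := h _ hκ
  set κ := s.regs 9 with hκ'
  set w := s.regs 6 with hw'
  have hw : w < n := hl.bound w hT
  have hp : s.mem 3 (κ * n + w) < s.mem 1 κ := hl.pos_lt w hT
  have hcn : s.mem 1 κ ≤ n := hl.le
  obtain ⟨c, hc'⟩ : ∃ c, s.mem 1 κ = c + 1 := ⟨s.mem 1 κ - 1, by omega⟩
  rw [hc'] at hl hp hcn
  have hl' := hl.erase hT
  have hx : s.mem 2 (κ * n + c) < n := hl.bound _ (hl.mem c (by omega))
  set p := s.mem 3 (κ * n + w) with hp'
  set x := s.mem 2 (κ * n + c) with hx'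
  have b1 := hW.entry hκ hcn
  have b2 := hW.entry hκ hw
  have b3 : κ * n < W := by omega
  have b4 := hW.one_lt
  have b5 := hW.entry hκ (show p < n by omega)
  have b6 := hW.entry hκ hx
  have e1 : (listErase.run W s).mem 1 = Function.update (s.mem 1) κ c := by
    simp [listErase, Cmd.run, ← hκ', hc', Nat.mod_eq_of_lt b4, MState.mem_setMem_of_ne]
  have e2 : (listErase.run W s).mem 2 = Function.update (s.mem 2) (κ * n + p) x := by
    simp [listErase, Cmd.run, hn, ← hκ', ← hw', hc', ← hp', ← hx', Nat.mod_eq_of_lt b1,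
      Nat.mod_eq_of_lt b2, Nat.mod_eq_of_lt b3, Nat.mod_eq_of_lt b4, Nat.mod_eq_of_lt b5,
      MState.mem_setMem_of_ne]
  -- If the erased node is the last entry, the preceding store hits the very cell that is read next,
  -- but the value written there is `x` again.
  have e4 : Function.update (s.mem 2) (κ * n + p) x (κ * n + c) = x := by
    rw [Function.update_apply]; split_ifs <;> rfl
  have e3 : (listErase.run W s).mem 3 = Function.update (s.mem 3) (κ * n + x) p := by
    simp [listErase, Cmd.run, hn, ← hκ', ← hw', hc', ← hp', ← hx', Nat.mod_eq_of_lt b1,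
      Nat.mod_eq_of_lt b2, Nat.mod_eq_of_lt b3, Nat.mod_eq_of_lt b4, Nat.mod_eq_of_lt b5, e4,
      Nat.mod_eq_of_lt b6, MState.mem_setMem_of_ne]
  refine ⟨⟨by simp [listErase, Cmd.run], fun a ha => ?_⟩, by simp [listErase, Cmd.run],
    fun κ' hne => contrib_congr ?_ ?_, h.replace (κ := κ) ?_ ?_ ?_ ?_ ?_⟩
  · simp only [Set.mem_insert_iff, Set.mem_singleton_iff, not_or] at ha
    simp [listErase, Cmd.run, MState.mem_setMem_of_ne, ha.1, ha.2.1, ha.2.2]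
  · rw [e1, Function.update_of_ne hne]
  · rw [e2]
    simpa using update_other_row (s.mem 2) (x := x) hne (show p < n by omega) (show 0 < n by omega)
  · intro κ' hne
    rw [e1, Function.update_of_ne hne]
  · intro κ' hne j hj
    rw [e2, update_other_row _ hne (by omega) hj]
  · intro κ' hne j hj
    rw [e3, update_other_row _ hne hx hj]
  · intro κ' hne x
    simp [hne]
  · rw [e1, e2, e3, Function.update_self]
    simp only [update_row]
    convert hl' using 1
    ext x
    simp

/-- Changing a list may change its first element. Therefore its whole contribution is withdrawn, the
list is changed, and the new contribution is added, while the sum over the other lists stays the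
same. Those `n ^ 3 - 1` lists account for at most `2 * n ^ 3 - 2` pairs, which leaves the room that
the counter bounds ask for. -/
theorem modify_spec (hW : Fits W n) {T : Set (ℕ × ℕ)} (hn : s.regs 0 = n)
    (hκ : s.regs 9 < n ^ 3) (hw : s.regs 6 < n) (hT : FlagOk (s.regs 1) T {(s.regs 9, s.regs 6)})
    (h : Represents n T s) :
    SameBut {1, 2, 3, 4} s (modify.run W s) ∧
      Represents n (applyFlag (s.regs 1) T {(s.regs 9, s.regs 6)}) (modify.run W s) := by
  obtain ⟨hl, hc⟩ := h
  have hκ' : s.regs 9 ∈ Finset.range (n ^ 3) := Finset.mem_range.2 hκ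
  rw [← Finset.add_sum_erase _ _ hκ'] at hc
  have hcard := card_sum_contrib_le n s.mem ((Finset.range (n ^ 3)).erase (s.regs 9))
  rw [Finset.card_erase_of_mem hκ', Finset.card_range] at hcard
  have hM : (∑ κ ∈ (Finset.range (n ^ 3)).erase (s.regs 9), contrib n s.mem κ).card + 2 ≤
      2 * n ^ 3 := by omega
  obtain ⟨hs1, hc1⟩ := unlink_spec hW hn hκ hM hc
  rw [modify]
  simp only [Cmd.run]
  set s1 := unlink.run W s with hs1'
  set κ := s.regs 9
  have m1 := hs1.mem 1 (by simp)
  have m2 := hs1.mem 2 (by simp)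
  have m3 := hs1.mem 3 (by simp)
  have hl1 : ListsRep n T s1.mem := by
    intro κ' h'
    rw [m1, m2, m3]
    exact hl κ' h'
  have key : ∃ s2, s2 = (if Expr.eval W s1 (Expr.reg 1) = 0 then Cmd.run W listErase s1
      else Cmd.run W listInsert s1) ∧ SameBut {1, 2, 3} s1 s2 ∧ s2.out = s1.out ∧
      (∀ κ' ≠ κ, contrib n s2.mem κ' = contrib n s1.mem κ') ∧
      ListsRep n (applyFlag (s.regs 1) T {(κ, s.regs 6)}) s2.mem := by
    refine ⟨_, rfl, ?_⟩
    have hr := hs1.regs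
    rw [Expr.eval_reg, hr]
    unfold FlagOk at hT
    unfold applyFlag
    split_ifs at hT ⊢ with hf
    · have := listErase_spec (s := s1) hW (by rw [hr, hn]) (by rw [hr]; exact hκ)
        (by rw [hr]; exact hT rfl) hl1
      rwa [hr] at this
    · have := listInsert_spec (s := s1) hW (by rw [hr, hn]) (by rw [hr]; exact hκ)
        (by rw [hr]; exact hw) (by rw [hr]; exact Set.disjoint_singleton_right.1 hT) hl1
      rwa [hr] at this
  obtain ⟨s2, hs2', hs2, ho, hcon, hl2⟩ := key
  rw [← hs2']
  have hr : s2.regs = s.regs := hs2.regs.trans hs1.regs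
  have hc2 : CountRep n (∑ κ ∈ (Finset.range (n ^ 3)).erase κ, contrib n s.mem κ) (s2.mem 4)
      s2.out := by
    rw [hs2.mem 4 (by simp), ho]
    exact hc1
  obtain ⟨hs3, hc3⟩ := link_spec hW (s := s2) (by rw [hr, hn]) (by rw [hr]; exact hκ) hM
    (fun h0 => by
      rw [hr] at h0 ⊢
      have := hl2 κ hκ
      simpa using this.bound _ (this.mem 0 (Nat.pos_of_ne_zero h0))) hc2
  refine ⟨(hs1.mono (by simp)).trans ((hs2.mono (by intro; simp; tauto)).trans
    (hs3.mono (by simp))), ?_, ?_⟩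
  · intro κ' h'
    rw [hs3.mem 1 (by simp), hs3.mem 2 (by simp), hs3.mem 3 (by simp)]
    exact hl2 κ' h'
  · rw [← Finset.add_sum_erase _ _ hκ']
    have e3 : ∀ κ', contrib n (link.run W s2).mem κ' = contrib n s2.mem κ' := fun κ' =>
      contrib_congr (by rw [hs3.mem 1 (by simp)]) (by rw [hs3.mem 2 (by simp)])
    have e4 : ∑ κ' ∈ (Finset.range (n ^ 3)).erase κ, contrib n (link.run W s2).mem κ' =
        ∑ κ' ∈ (Finset.range (n ^ 3)).erase κ, contrib n s.mem κ' := by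
      refine Finset.sum_congr rfl fun κ' h' => ?_
      rw [e3, hcon κ' (Finset.ne_of_mem_erase h')]
      exact contrib_congr (by rw [m1]) (by rw [m2])
    rw [e4, e3]
    rwa [hr] at hc3

end Prog

/-! ## The sets held by the lists -/

/-- The number of the list of common neighbours of `u` and `x`. -/
def pairKey (n u x : ℕ) : ℕ := (min u x * n + max u x) * n

/-- The number of the list of neighbours of `u` in the group of `v`, where `q` is the group size. -/
def leadKey (n q u v : ℕ) : ℕ := (u * n + u) * n + v / q

/-- The contents of the lists for the graph `g`: common neighbours of two nodes in the same group, and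
neighbours of a node in a group. -/
def keys (n q : ℕ) (g : ℕ → ℕ → Prop) : Set (ℕ × ℕ) :=
  {p | (∃ a b, a < b ∧ a / q = b / q ∧ g a p.2 ∧ g b p.2 ∧ p.1 = pairKey n a b) ∨
    ∃ u, g u p.2 ∧ p.1 = leadKey n q u p.2}

/-- The changes of the lists caused by the oriented edge from `u` to `v`, restricted to the first `j`
nodes of the group of `u`. -/
def halfKeys (n q : ℕ) (g : ℕ → ℕ → Prop) (u v j : ℕ) : Set (ℕ × ℕ) :=
  {(leadKey n q u v, v)} ∪
    {p | ∃ i < j, g (u / q * q + i) v ∧ p = (pairKey n u (u / q * q + i), v)}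

/-- The adjacency relation after adding an edge. -/
def addEdge (g : ℕ → ℕ → Prop) (u v x y : ℕ) : Prop :=
  g x y ∨ x = u ∧ y = v ∨ x = v ∧ y = u

/-- A symmetric and irreflexive relation on the numbers below `n`. -/
structure IsAdj (n : ℕ) (g : ℕ → ℕ → Prop) : Prop where
  lt : ∀ {x y}, g x y → x < n
  symm : ∀ {x y}, g x y → g y x
  irrefl : ∀ x, ¬ g x x

theorem pairKey_comm (n u x : ℕ) : pairKey n u x = pairKey n x u := by
  rw [pairKey, pairKey, min_comm, max_comm]

theorem pairKey_of_lt {n u x : ℕ} (h : u < x) : pairKey n u x = (u * n + x) * n := by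
  rw [pairKey, min_eq_left h.le, max_eq_right h.le]

theorem key_lt {n a b i : ℕ} (ha : a < n) (hb : b < n) (hi : i < n) :
    (a * n + b) * n + i < n ^ 3 := by
  have := Prog.flat_lt (Prog.flat_lt ha hb) hi
  rwa [pow_succ, pow_two]

theorem pairKey_lt {n a b : ℕ} (ha : a < n) (hb : b < n) : pairKey n a b < n ^ 3 :=
  key_lt (i := 0) (by omega) (by omega) (by omega)

theorem leadKey_lt {n q a b : ℕ} (ha : a < n) (hb : b < n) : leadKey n q a b < n ^ 3 :=
  key_lt ha ha ((Nat.div_le_self _ _).trans_lt hb)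

theorem pairKey_inj {n a b a' b' : ℕ} (ha : a < n) (hb : b < n) (ha' : a' < n) (hb' : b' < n)
    (h : pairKey n a b = pairKey n a' b') : a = a' ∧ b = b' ∨ a = b' ∧ b = a' := by
  unfold pairKey at h
  have h1 := Nat.eq_of_mul_eq_mul_right (by omega) h
  have h2 := (flat_index_inj (by omega) (by omega)).1 h1
  omega

/-- Lists of common neighbours sit at off-diagonal cells `(a, b)`, lists of neighbours at diagonal
cells `(u, u)`. -/
theorem pairKey_ne_leadKey {n q a b u v : ℕ} (ha : a < n) (hb : b < n) (hu : u < n) (hv : v < n)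
    (hab : a ≠ b) : pairKey n a b ≠ leadKey n q u v := by
  intro h
  have hv' : v / q < n := (Nat.div_le_self _ _).trans_lt hv
  have h1 := ((flat_index_inj (show 0 < n by omega) hv').1 (by rw [add_zero]; exact h)).1
  have h2 := (flat_index_inj (by omega) (by omega)).1 h1
  omega

theorem leadKey_inj {n q u v u' v' : ℕ} (hu : u < n) (hu' : u' < n) (hv : v < n) (hv' : v' < n)
    (h : leadKey n q u v = leadKey n q u' v') : u = u' ∧ v / q = v' / q := by
  obtain ⟨h1, h2⟩ := (flat_index_inj ((Nat.div_le_self _ _).trans_lt hv)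
    ((Nat.div_le_self _ _).trans_lt hv')).1 h
  exact ⟨((flat_index_inj hu hu').1 h1).1, h2⟩

/-- After `q` steps the offset has run over the whole block of numbers with quotient `u / q`, so the
loop index can be eliminated. -/
theorem mem_halfKeys {n q : ℕ} {g : ℕ → ℕ → Prop} {u v : ℕ} (hq : 0 < q) {p : ℕ × ℕ} :
    p ∈ halfKeys n q g u v q ↔ p.2 = v ∧
      (p.1 = leadKey n q u v ∨ ∃ x, x / q = u / q ∧ g x v ∧ p.1 = pairKey n u x) := by
  obtain ⟨κ, w⟩ := p
  simp only [halfKeys, Set.mem_union, Set.mem_singleton_iff, Set.mem_ofPred_eq, Prod.mk.injEq]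
  constructor
  · rintro (⟨h1, rfl⟩ | ⟨i, hi, h1, h2, rfl⟩)
    · exact ⟨rfl, Or.inl h1⟩
    · refine ⟨rfl, Or.inr ⟨_, ?_, h1, h2⟩⟩
      rw [mul_comm, Nat.mul_add_div hq, Nat.div_eq_of_lt hi, add_zero]
  · rintro ⟨rfl, h1 | ⟨x, hx, h1, h2⟩⟩
    · exact Or.inl ⟨h1, rfl⟩
    · have hx' : u / q * q + x % q = x := by rw [← hx]; exact Nat.div_add_mod' x q
      exact Or.inr ⟨x % q, Nat.mod_lt _ hq, by rwa [hx'], by rwa [hx'], rfl⟩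

theorem halfKeys_succ (n q : ℕ) (g : ℕ → ℕ → Prop) (u v j : ℕ) :
    halfKeys n q g u v (j + 1) = halfKeys n q g u v j ∪
      {p | g (u / q * q + j) v ∧ p = (pairKey n u (u / q * q + j), v)} := by
  ext p
  simp only [halfKeys, Set.mem_union, Set.mem_singleton_iff, Set.mem_ofPred_eq, Nat.lt_succ_iff_lt_or_eq,
    or_and_right, exists_or, exists_eq_left, or_assoc]

theorem halfKeys_mono {n q : ℕ} {g : ℕ → ℕ → Prop} {u v i j : ℕ} (h : i ≤ j) :
    halfKeys n q g u v i ⊆ halfKeys n q g u v j :=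
  Set.union_subset_union_right _ fun _ ⟨k, hk, h'⟩ => ⟨k, hk.trans_le h, h'⟩

theorem halfKeys_zero (n q : ℕ) (g : ℕ → ℕ → Prop) (u v : ℕ) :
    halfKeys n q g u v 0 = {(leadKey n q u v, v)} := by
  simp [halfKeys]

section

variable {n q : ℕ} {g : ℕ → ℕ → Prop} {u v : ℕ}

theorem IsAdj.lt' (hg : IsAdj n g) {x y : ℕ} (h : g x y) : y < n := hg.lt (hg.symm h)

/-- Different steps of the loop concern different lists, so no pair is changed twice. The absence of
the edge `uv` rules out `x = u`. -/
theorem pairKey_notMem_halfKeys (hg : IsAdj n g) (hu : u < n) (hv : v < n) (huv : ¬ g u v) {j : ℕ}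
    (hx : g (u / q * q + j) v) : (pairKey n u (u / q * q + j), v) ∉ halfKeys n q g u v j := by
  have hne : u ≠ u / q * q + j := fun h => huv (by rwa [← h] at hx)
  simp only [halfKeys, Set.mem_union, Set.mem_singleton_iff, Set.mem_ofPred_eq, Prod.mk.injEq, not_or,
    and_true]
  refine ⟨pairKey_ne_leadKey hu (hg.lt hx) hu hv hne, ?_⟩
  rintro ⟨i, hi, hi', h⟩
  rcases pairKey_inj hu (hg.lt hx) hu (hg.lt hi') h with h | h <;> omega

theorem halfKeys_subset_keys (hq : 0 < q) (huv : ¬ g u v) :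
    halfKeys n q g u v q ⊆ keys n q (addEdge g u v) := by
  rintro ⟨κ, w⟩ hp
  obtain ⟨hw, hp⟩ := (mem_halfKeys hq).1 hp
  obtain rfl : w = v := hw
  simp only at hp
  obtain rfl | ⟨x, hx, h1, rfl⟩ := hp
  · exact Or.inr ⟨u, Or.inr (Or.inl ⟨rfl, rfl⟩), rfl⟩
  · rcases lt_trichotomy u x with h | rfl | h
    · exact Or.inl ⟨u, x, h, hx.symm, Or.inr (Or.inl ⟨rfl, rfl⟩), Or.inl h1, rfl⟩
    · exact absurd h1 huv
    · exact Or.inl ⟨x, u, h, hx, Or.inl h1, Or.inr (Or.inl ⟨rfl, rfl⟩), pairKey_comm _ _ _⟩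

theorem addEdge_comm (g : ℕ → ℕ → Prop) (u v : ℕ) : addEdge g u v = addEdge g v u := by
  ext x y
  unfold addEdge
  tauto

theorem keys_mono {g' : ℕ → ℕ → Prop} (h : ∀ x y, g x y → g' x y) : keys n q g ⊆ keys n q g' := by
  rintro p (⟨a, b, h1, h2, h3, h4, h5⟩ | ⟨a, h1, h2⟩)
  · exact Or.inl ⟨a, b, h1, h2, h _ _ h3, h _ _ h4, h5⟩
  · exact Or.inr ⟨a, h _ _ h1, h2⟩

/-- A new element `w` of a list owes its membership to the new edge: `w` is one end and an owner of
the list is the other. In a list of common neighbours of `a < b` the edges to `w` cannot both be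
new, as this would force `a = b` or `u = v`. -/
theorem keys_addEdge (hq : 0 < q) (huv : ¬ g u v) (hvu : ¬ g v u) (hne : u ≠ v) :
    keys n q (addEdge g u v) = keys n q g ∪ (halfKeys n q g u v q ∪ halfKeys n q g v u q) := by
  apply Set.Subset.antisymm
  · rintro ⟨κ, w⟩ (⟨a, b, h1, h2, h3, h4, h5⟩ | ⟨a, h1, h2⟩)
    · simp only at h3 h4 h5
      subst h5
      rcases h3 with h3 | ⟨rfl, rfl⟩ | ⟨rfl, rfl⟩
      · rcases h4 with h4 | ⟨rfl, rfl⟩ | ⟨rfl, rfl⟩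
        · exact Or.inl (Or.inl ⟨a, b, h1, h2, h3, h4, rfl⟩)
        · exact Or.inr (Or.inl ((mem_halfKeys hq).2
            ⟨rfl, Or.inr ⟨a, h2, h3, pairKey_comm _ _ _⟩⟩))
        · exact Or.inr (Or.inr ((mem_halfKeys hq).2
            ⟨rfl, Or.inr ⟨a, h2, h3, pairKey_comm _ _ _⟩⟩))
      · rcases h4 with h4 | ⟨rfl, -⟩ | ⟨rfl, h⟩
        · exact Or.inr (Or.inl ((mem_halfKeys hq).2 ⟨rfl, Or.inr ⟨b, h2.symm, h4, rfl⟩⟩))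
        · omega
        · exact absurd h.symm hne
      · rcases h4 with h4 | ⟨rfl, h⟩ | ⟨rfl, -⟩
        · exact Or.inr (Or.inr ((mem_halfKeys hq).2 ⟨rfl, Or.inr ⟨b, h2.symm, h4, rfl⟩⟩))
        · exact absurd h hne
        · omega
    · simp only at h1 h2
      subst h2
      rcases h1 with h1 | ⟨rfl, rfl⟩ | ⟨rfl, rfl⟩
      · exact Or.inl (Or.inr ⟨a, h1, rfl⟩)
      · exact Or.inr (Or.inl ((mem_halfKeys hq).2 ⟨rfl, Or.inl rfl⟩))
      · exact Or.inr (Or.inr ((mem_halfKeys hq).2 ⟨rfl, Or.inl rfl⟩))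
  · refine Set.union_subset (keys_mono fun x y => Or.inl) (Set.union_subset ?_ ?_)
    · exact halfKeys_subset_keys hq huv
    · rw [addEdge_comm]
      exact halfKeys_subset_keys hq hvu

/-- Every pair in `halfKeys` places `v` into a list owned by `u`; being present already would mean
`g u v`. -/
theorem disjoint_keys_halfKeys (hq : 0 < q) (hg : IsAdj n g) (hu : u < n) (hv : v < n)
    (huv : ¬ g u v) : Disjoint (keys n q g) (halfKeys n q g u v q) := by
  rw [Set.disjoint_left]
  rintro ⟨κ, w⟩ h h'
  obtain ⟨rfl, h'⟩ := (mem_halfKeys hq).1 h'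
  simp only at h'
  rcases h with ⟨a, b, h1, h2, h3, h4, h5⟩ | ⟨a, h1, h2⟩
  · simp only at h3 h4 h5
    rcases h' with h' | ⟨x, hx, h6, h'⟩
    · exact pairKey_ne_leadKey (hg.lt h3) (hg.lt h4) hu hv h1.ne (h5.symm.trans h')
    · rcases pairKey_inj (hg.lt h3) (hg.lt h4) hu (hg.lt h6) (h5.symm.trans h') with
        ⟨rfl, -⟩ | ⟨-, rfl⟩
      · exact huv h3
      · exact huv h4
  · simp only at h1 h2
    rcases h' with h' | ⟨x, hx, h6, h'⟩
    · obtain ⟨rfl, -⟩ := leadKey_inj (hg.lt h1) hu hv hv (h2.symm.trans h')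
      exact huv h1
    · exact pairKey_ne_leadKey hu (hg.lt h6) (hg.lt h1) hv (fun h => huv (by rwa [h]))
        (h'.symm.trans h2)

theorem disjoint_halfKeys (hq : 0 < q) (hne : u ≠ v) :
    Disjoint (halfKeys n q g u v q) (halfKeys n q g v u q) := by
  rw [Set.disjoint_left]
  intro p h h'
  exact hne (((mem_halfKeys hq).1 h').1.symm.trans ((mem_halfKeys hq).1 h).1)

end

theorem FlagOk.mono {f : ℕ} {T D E : Set (ℕ × ℕ)} (h : FlagOk f T E) (hD : D ⊆ E) : FlagOk f T D := by
  rw [← Set.union_eq_self_of_subset_left hD] at h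
  exact h.left

/-- Array `0` holds the adjacency matrix. -/
def AdjRep (n : ℕ) (a : ℕ → ℕ) (g : ℕ → ℕ → Prop) : Prop :=
  ∀ x y, y < n → (a (x * n + y) ≠ 0 ↔ g x y)

/-- It does not matter whether the matrix contained the edge before: both cells are overwritten, and
elsewhere the two relations agree. -/
theorem AdjRep.set {n : ℕ} {a : ℕ → ℕ} {g g' : ℕ → ℕ → Prop} {u v : ℕ} (h : AdjRep n a g')
    (hu : u < n) (hv : v < n) (hg : g' = g ∨ g' = addEdge g u v) (huv : ¬ g u v) (hvu : ¬ g v u)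
    (c : ℕ) : AdjRep n (Function.update (Function.update a (u * n + v) c) (v * n + u) c)
      (if c = 0 then g else addEdge g u v) := by
  intro x y hy
  simp only [Function.update_apply, flat_index_inj hy hu, flat_index_inj hy hv]
  have h1 := h x y hy
  by_cases e1 : x = v ∧ y = u
  · obtain ⟨rfl, rfl⟩ := e1
    by_cases hc : c = 0
    · simpa [hc] using hvu
    · simp [hc, addEdge]
  · by_cases e2 : x = u ∧ y = v
    · obtain ⟨rfl, rfl⟩ := e2
      by_cases hc : c = 0
      · simpa [hc] using huv
      · simp [hc, addEdge]
    · rw [if_neg e1, if_neg e2, h1]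
      rcases hg with rfl | rfl <;> split_ifs <;> simp [addEdge, e1, e2]

/-! ### Correctness of the loop over a group. -/

namespace Prog

variable {W n : ℕ} {s : MState} {g : ℕ → ℕ → Prop}

theorem modify_simple : modify.Simple := by
  simp [modify, unlink, link, inc, dec, listInsert, listErase, Cmd.Simple]

theorem body_simple : body.Simple := by simp [body, Cmd.Simple, modify_simple]

theorem lead_simple : lead.Simple := by simp [lead, Cmd.Simple, modify_simple]

/-- The state in the loop after `j` steps. -/
structure LoopInv (n : ℕ) (T : Set (ℕ × ℕ)) (s : MState) (j : ℕ) (t : MState) : Prop where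
  regs : ∀ r < 7, t.regs r = s.regs r
  counter : t.regs 7 = j
  mem : t.mem 0 = s.mem 0
  rep : Represents n T t

theorem lead_spec (hW : Fits W n) {T : Set (ℕ × ℕ)} {q u v : ℕ} (hn : s.regs 0 = n)
    (hq' : s.regs 4 = q) (hu' : s.regs 5 = u) (hv' : s.regs 6 = v) (hu : u < n) (hv : v < n)
    (hT : FlagOk (s.regs 1) T (halfKeys n q g u v 0)) (h : Represents n T s) :
    LoopInv n (applyFlag (s.regs 1) T (halfKeys n q g u v 0)) s 0 (lead.run W s) := by
  have b1 := hW.cell hu hu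
  have b2 := leadKey_lt (q := q) hu hv
  have b3 : leadKey n q u v < W := by have := hW.cube; omega
  unfold leadKey at b3
  have e : Expr.eval W s ((.reg 5 * .reg 0 + .reg 5) * .reg 0 + .reg 6 / .reg 4) = leadKey n q u v := by
    simp [hn, hq', hu', hv', leadKey, Nat.mod_eq_of_lt b1, Nat.mod_eq_of_lt b3,
      Nat.mod_eq_of_lt (show u * n < W by omega),
      Nat.mod_eq_of_lt ((Nat.le_add_right _ _).trans_lt b3)]
  have hk : s.setReg 9 (leadKey n q u v) = Cmd.run W (.assign 9
      ((.reg 5 * .reg 0 + .reg 5) * .reg 0 + .reg 6 / .reg 4)) s := by rw [Cmd.run, e]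
  rw [halfKeys_zero] at hT ⊢
  have hm := modify_spec (s := s.setReg 9 (leadKey n q u v)) (T := T) hW (by simp [hn])
    (by simpa using b2) (by simp [hv', hv]) (by simpa [hv'] using hT) ⟨h.1, h.2⟩
  obtain ⟨hs, hr⟩ := hm
  simp only [lead, Cmd.run, e]
  refine ⟨fun r hr => ?_, by simp, ?_, ?_⟩
  · simp [hs.regs, Function.update_of_ne (show r ≠ 7 by omega),
      Function.update_of_ne (show r ≠ 9 by omega)]
  · simpa using hs.mem 0 (by simp)
  · have hr' : Represents n (applyFlag (s.regs 1) T {(leadKey n q u v, v)})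
        (modify.run W (s.setReg 9 (leadKey n q u v))) := by simpa [hv'] using hr
    exact ⟨hr'.1, hr'.2⟩

theorem body_spec (hW : Fits W n) {T : Set (ℕ × ℕ)} {q u v j : ℕ} (hg : IsAdj n g) {t : MState}
    (hqn : q ≤ n) (hn : s.regs 0 = n)
    (hq' : s.regs 4 = q) (hu' : s.regs 5 = u) (hv' : s.regs 6 = v) (hu : u < n) (hv : v < n)
    (huv : ¬ g u v) (hj : j < q) (ha : AdjRep n (s.mem 0) g)
    (hT : FlagOk (s.regs 1) T (halfKeys n q g u v (j + 1)))
    (h : LoopInv n (applyFlag (s.regs 1) T (halfKeys n q g u v j)) s j t) :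
    LoopInv n (applyFlag (s.regs 1) T (halfKeys n q g u v (j + 1))) s (j + 1) (body.run W t) := by
  -- If the last group is incomplete, `x` may be `n` or more. The program then reads a row beyond
  -- the matrix, which is zero because `AdjRep` covers all rows; `x < 2 * n` keeps the index below
  -- the word size.
  set x := u / q * q + j with hx
  have hxu : x < u + q := by have := Nat.div_mul_le_self u q; omega
  have b0 : 8 * n < W := by
    have h1 := hW.square
    have h2 : 3 * n ≤ n ^ 2 := by rw [pow_two]; exact Nat.mul_le_mul_right _ hW.pos
    omega
  have bx : x * n + v < W := by
    have h1 := hW.square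
    have h2 : 3 * n ≤ n ^ 2 := by rw [pow_two]; exact Nat.mul_le_mul_right _ hW.pos
    have h3 : x * n ≤ 2 * n * n := Nat.mul_le_mul_right _ (by omega)
    have h4 : 2 * n * n = 2 * n ^ 2 := by ring
    omega
  have b1 := hW.one_lt
  have r0 := (h.regs 0 (by omega)).trans hn
  have r1 := h.regs 1 (by omega)
  have r4 := (h.regs 4 (by omega)).trans hq'
  have r5 := (h.regs 5 (by omega)).trans hu'
  have r6 := (h.regs 6 (by omega)).trans hv'
  have ex : Expr.eval W t (.reg 5 / .reg 4 * .reg 4 + .reg 7) = x := by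
    simp [r4, r5, h.counter, ← hx, Nat.mod_eq_of_lt (show u / q * q < W by omega),
      Nat.mod_eq_of_lt (show x < W by omega)]
  have ec : Expr.eval W (t.setReg 8 x) (.load 0 (.reg 8 * .reg 0 + .reg 6)) = s.mem 0 (x * n + v) := by
    simp [r0, r6, h.mem, Nat.mod_eq_of_lt bx, Nat.mod_eq_of_lt (show x * n < W by omega)]
  have hax := ha x v hv
  -- The instruction shared by both branches: the lists already reflect `j + 1` steps while the
  -- counter still holds `j`.
  have last : ∀ t' : MState, t'.regs 7 = j → LoopInv n
      (applyFlag (s.regs 1) T (halfKeys n q g u v (j + 1))) s j t' →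
      LoopInv n (applyFlag (s.regs 1) T (halfKeys n q g u v (j + 1))) s (j + 1)
        (Cmd.run W (.assign 7 (.reg 7 + .const 1)) t') := by
    intro t' h7 ht'
    refine ⟨fun r hr => ?_, ?_, ht'.mem, ht'.rep.1, ht'.rep.2⟩
    · rw [← ht'.regs r hr]
      simp [Cmd.run, Function.update_of_ne (show r ≠ 7 by omega)]
    · simp [Cmd.run, h7, Nat.mod_eq_of_lt b1, Nat.mod_eq_of_lt (show j + 1 < W by omega)]
  simp only [body, Cmd.run, ex, ec] at last ⊢
  by_cases hgx : g x v
  · rw [if_neg (hax.2 hgx)]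
    have hxn := hg.lt hgx
    have hne : u ≠ x := fun h => huv (by rwa [h])
    have bk := pairKey_lt hu hxn
    have bk' : pairKey n u x < W := by have := hW.cube; omega
    have ek : (if Expr.eval W (t.setReg 8 x) (.op .lt (.reg 5) (.reg 8)) = 0 then
        (t.setReg 8 x).setReg 9
          (Expr.eval W (t.setReg 8 x) ((.reg 8 * .reg 0 + .reg 5) * .reg 0)) else
        (t.setReg 8 x).setReg 9
          (Expr.eval W (t.setReg 8 x) ((.reg 5 * .reg 0 + .reg 8) * .reg 0))) =
        (t.setReg 8 x).setReg 9 (pairKey n u x) := by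
      have c1 := hW.cell hu hxn
      have c2 := hW.cell hxn hu
      rcases lt_or_gt_of_ne hne with hlt | hlt
      · rw [pairKey_of_lt hlt] at bk' ⊢
        simp [r0, r5, hlt, Nat.mod_eq_of_lt b1, Nat.mod_eq_of_lt c1, Nat.mod_eq_of_lt bk',
          Nat.mod_eq_of_lt (show u * n < W by omega)]
      · rw [pairKey_comm, pairKey_of_lt hlt] at bk' ⊢
        simp [r0, r5, hlt.not_gt, Nat.mod_eq_of_lt c2, Nat.mod_eq_of_lt bk',
          Nat.mod_eq_of_lt (show x * n < W by omega)]
    rw [ek]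
    have hk : halfKeys n q g u v (j + 1) = halfKeys n q g u v j ∪ {(pairKey n u x, v)} := by
      rw [halfKeys_succ]
      simp only [← hx, hgx, true_and]
      rfl
    have hok : FlagOk (s.regs 1) (applyFlag (s.regs 1) T (halfKeys n q g u v j))
        {(pairKey n u x, v)} := by
      rw [hk] at hT
      exact hT.right (Set.disjoint_singleton_right.2 (pairKey_notMem_halfKeys hg hu hv huv hgx))
    obtain ⟨hs, hr⟩ := modify_spec (s := (t.setReg 8 x).setReg 9 (pairKey n u x)) hW (by simp [r0])
      (by simpa using bk) (by simp [r6, hv]) (by simpa [r1, r6] using hok) ⟨h.rep.1, h.rep.2⟩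
    apply last
    · simp [hs.regs, h.counter]
    refine ⟨fun r hr' => ?_, ?_, ?_, ?_⟩
    · rw [← h.regs r hr']
      simp [hs.regs, Function.update_of_ne (show r ≠ 8 by omega),
        Function.update_of_ne (show r ≠ 9 by omega)]
    · simp [hs.regs, h.counter]
    · rw [← h.mem]
      simpa using hs.mem 0 (by simp)
    · rw [hk, ← applyFlag_union]
      simpa [r1, r6] using hr
  · rw [if_pos (not_not.1 (mt hax.1 hgx))]
    have hk : halfKeys n q g u v (j + 1) = halfKeys n q g u v j := by
      rw [halfKeys_succ]
      simp [← hx, hgx]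
    apply last
    · simp [h.counter]
    rw [hk]
    refine ⟨fun r hr' => ?_, by simp [h.counter], h.mem, h.rep.1, h.rep.2⟩
    rw [← h.regs r hr']
    simp [Function.update_of_ne (show r ≠ 8 by omega)]

/-- A bound for the running time of `half` with groups of `q` nodes. -/
def halfBound (q : ℕ) : ℕ := lead.bound + (q * (cond.cost + 1 + body.bound) + (cond.cost + 1))

theorem half_spec (hW : Fits W n) {T : Set (ℕ × ℕ)} {q u v : ℕ} (hg : IsAdj n g) (ω : ℕ → ℕ)
    (hqn : q ≤ n) (hn : s.regs 0 = n)
    (hq' : s.regs 4 = q) (hu' : s.regs 5 = u) (hv' : s.regs 6 = v) (hu : u < n) (hv : v < n)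
    (huv : ¬ g u v) (ha : AdjRep n (s.mem 0) g)
    (hT : FlagOk (s.regs 1) T (halfKeys n q g u v q)) (h : Represents n T s) :
    ∃ s', Reaches W ω half s s' (halfBound q) ∧ (∀ r < 5, s'.regs r = s.regs r) ∧
      s'.mem 0 = s.mem 0 ∧ Represents n (applyFlag (s.regs 1) T (halfKeys n q g u v q)) s' := by
  have h0 := lead_spec hW hn hq' hu' hv' hu hv (hT.mono (halfKeys_mono (Nat.zero_le q))) h
  have b1 := hW.one_lt
  obtain ⟨s', hr, hs'⟩ := Reaches.loop (W := W) (ω := ω) (e := cond) (p := body) (b := body.bound)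
    (fun j t => LoopInv n (applyFlag (s.regs 1) T (halfKeys n q g u v j)) s j t) q
    (fun t ht => by simp [cond, ht.counter, ht.regs 4, hq'])
    (fun j hj t ht => ⟨by simp [cond, ht.counter, ht.regs 4, hq', hj, Nat.mod_eq_of_lt b1],
      _, body_simple.reaches t,
      body_spec hW hg hqn hn hq' hu' hv' hu hv huv hj ha (hT.mono (halfKeys_mono hj)) ht⟩)
    0 (Nat.zero_le q) _ h0
  exact ⟨s', (lead_simple.reaches s).seq hr, fun r hr => hs'.regs r (by omega), hs'.mem, hs'.rep⟩

end Prog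

theorem IsAdj.addEdge {n : ℕ} {g : ℕ → ℕ → Prop} (hg : IsAdj n g) {u v : ℕ} (hu : u < n) (hv : v < n)
    (hne : u ≠ v) : IsAdj n (addEdge g u v) where
  lt h := by
    rcases h with h | ⟨rfl, -⟩ | ⟨rfl, -⟩
    · exact hg.lt h
    · exact hu
    · exact hv
  symm h := by
    rcases h with h | h | h
    · exact Or.inl (hg.symm h)
    · exact Or.inr (Or.inr h.symm)
    · exact Or.inr (Or.inl h.symm)
  irrefl x h := by
    rcases h with h | ⟨rfl, h⟩ | ⟨rfl, h⟩
    · exact hg.irrefl x h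
    · exact hne h
    · exact hne h.symm

/-! ### Correctness of a whole update. -/

namespace Prog

variable {W n : ℕ} {s : MState} {g : ℕ → ℕ → Prop}

/-- The state of the algorithm between updates, for the graph `g` and groups of `q` nodes. -/
structure Inv (n q : ℕ) (g : ℕ → ℕ → Prop) (s : MState) : Prop where
  size : s.regs 0 = n
  group : s.regs 4 = q
  adj : AdjRep n (s.mem 0) g
  rep : Represents n (keys n q g) s

theorem setAdj_spec (hW : Fits W n) {u v c : ℕ} {e : Expr} (hn : s.regs 0 = n) (hu' : s.regs 2 = u)
    (hv' : s.regs 3 = v) (hu : u < n) (hv : v < n) (he : e.eval W s = c)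
    (he' : ∀ i x, e.eval W (s.setMem 0 i x) = c) :
    SameBut {0} s ((setAdj e).run W s) ∧ ((setAdj e).run W s).out = s.out ∧
      ((setAdj e).run W s).mem 0 =
        Function.update (Function.update (s.mem 0) (u * n + v) c) (v * n + u) c := by
  have b1 := hW.cell hu hv
  have b2 := hW.cell hv hu
  refine ⟨⟨by simp [setAdj, Cmd.run], fun a ha => ?_⟩, by simp [setAdj, Cmd.run], ?_⟩
  · simp only [Set.mem_singleton_iff] at ha
    simp [setAdj, Cmd.run, MState.mem_setMem_of_ne ha]
  · simp [setAdj, Cmd.run, hn, hu', hv', he, he', Nat.mod_eq_of_lt b1, Nat.mod_eq_of_lt b2,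
      Nat.mod_eq_of_lt (show u * n < W by omega), Nat.mod_eq_of_lt (show v * n < W by omega)]

theorem Represents.congr {T : Set (ℕ × ℕ)} {s s' : MState} (h : Represents n T s)
    (hm : ∀ a, a ≠ 0 → s'.mem a = s.mem a) (ho : s'.out = s.out) : Represents n T s' := by
  refine ⟨fun κ hκ => ?_, ?_⟩
  · rw [hm 1 (by simp), hm 2 (by simp), hm 3 (by simp)]
    exact h.lists κ hκ
  · rw [hm 4 (by simp), ho]
    have : ∀ κ, contrib n s'.mem κ = contrib n s.mem κ := fun κ =>
      contrib_congr (by rw [hm 1 (by simp)]) (by rw [hm 2 (by simp)])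
    simp only [this]
    exact h.counts

/-- A bound for the running time of an update with groups of `q` nodes. -/
def updateBound (q : ℕ) : ℕ :=
  before.bound + (halfBound q + (swap.bound + (halfBound q + (setAdj (.reg 1)).bound)))

/-- Here `g` is the graph without the edge, for both kinds of update. Clearing the matrix entries at
the start makes both loops read `g`, and the flag in register `1` finally serves as the new entry.
Disjointness of the two halves and of `keys n q g` supplies the preconditions of all list
operations. -/
theorem update_spec (hW : Fits W n) {q u v : ℕ} (hg : IsAdj n g) (ω : ℕ → ℕ)
    (hq : 0 < q) (hqn : q ≤ n) (hu' : s.regs 2 = u) (hv' : s.regs 3 = v) (hu : u < n) (hv : v < n)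
    (huv : ¬ g u v) (hne : u ≠ v)
    (h : Inv n q (if s.regs 1 = 0 then addEdge g u v else g) s) :
    ∃ s', Reaches W ω update s s' (updateBound q) ∧
      Inv n q (if s.regs 1 = 0 then g else addEdge g u v) s' := by
  have hvu : ¬ g v u := fun h' => huv (hg.symm h')
  set f := s.regs 1 with hf
  set g₁ := if f = 0 then addEdge g u v else g with hg₁
  have hg₁' : g₁ = g ∨ g₁ = addEdge g u v := by
    rw [hg₁]; split_ifs <;> simp
  set D₁ := halfKeys n q g u v q
  set D₂ := halfKeys n q g v u q
  have hk := keys_addEdge (n := n) hq huv hvu hne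
  have hd : Disjoint (keys n q g) (D₁ ∪ D₂) := Set.disjoint_union_right.2
    ⟨disjoint_keys_halfKeys hq hg hu hv huv, disjoint_keys_halfKeys hq hg hv hu hvu⟩
  have hok : FlagOk f (keys n q g₁) (D₁ ∪ D₂) := by
    unfold FlagOk
    rw [hg₁]
    split_ifs
    · rw [hk]; exact Set.subset_union_right
    · exact hd
  have hfin : applyFlag f (keys n q g₁) (D₁ ∪ D₂) =
      keys n q (if f = 0 then g else addEdge g u v) := by
    unfold applyFlag
    rw [hg₁]
    split_ifs
    · rw [hk, Set.union_sdiff_right]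
      exact hd.sdiff_eq_left
    · rw [hk]
  -- clear the adjacency
  obtain ⟨ha, hao, ham⟩ := setAdj_spec (s := s) (e := .const 0) (c := 0) hW h.size hu' hv' hu hv
    (by simp) (by simp)
  set s1 := before.run W s with hs1
  have e1 : s1 = (((setAdj (.const 0)).run W s).setReg 5 u).setReg 6 v := by
    simp [hs1, before, Cmd.run, ha.regs, hu', hv']
  have r1 : ∀ r < 5, s1.regs r = s.regs r := fun r hr => by
    simp [e1, ha.regs, Function.update_of_ne (show r ≠ 5 by omega),
      Function.update_of_ne (show r ≠ 6 by omega)]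
  have m1 : AdjRep n (s1.mem 0) g := by
    have := h.adj.set hu hv hg₁' huv hvu 0
    rw [e1]
    simp only [MState.mem_setReg, ham]
    simpa using this
  have rep1 : Represents n (keys n q g₁) s1 :=
    Represents.congr h.rep (fun a h0 => by rw [e1]; exact ha.mem a (by simpa using h0))
      (by rw [e1]; exact hao)
  have hbefore : Reaches W ω before s s1 before.bound :=
    Cmd.Simple.reaches (by simp [before, setAdj, Cmd.Simple]) s
  -- the first orientation
  obtain ⟨s2, hr2, r2, m2, rep2⟩ := half_spec (s := s1) hW hg ω hqn ((r1 0 (by omega)).trans h.size)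
    ((r1 4 (by omega)).trans h.group) (u := u) (v := v) (by simp [e1]) (by simp [e1]) hu hv huv m1
    (by rw [r1 1 (by omega)]; exact hok.left) rep1
  set s3 := swap.run W s2 with hs3
  have e3 : s3 = (s2.setReg 5 v).setReg 6 u := by
    simp [hs3, swap, Cmd.run, r2, r1, hu', hv']
  have r3 : ∀ r < 5, s3.regs r = s.regs r := fun r hr => by
    rw [← r1 r hr, ← r2 r hr]
    simp [e3, Function.update_of_ne (show r ≠ 5 by omega), Function.update_of_ne (show r ≠ 6 by omega)]
  have hswap : Reaches W ω swap s2 s3 swap.bound :=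
    Cmd.Simple.reaches (by simp [swap, Cmd.Simple]) s2
  rw [r1 1 (by omega)] at rep2
  have rep3 : Represents n (applyFlag f (keys n q g₁) D₁) s3 :=
    Represents.congr rep2 (fun a _ => by rw [e3]; rfl) (by rw [e3]; rfl)
  -- the second orientation
  obtain ⟨s4, hr4, r4, m4, rep4⟩ := half_spec (s := s3) hW hg ω hqn ((r3 0 (by omega)).trans h.size)
    ((r3 4 (by omega)).trans h.group) (u := v) (v := u) (by simp [e3]) (by simp [e3]) hv hu hvu
    (by rw [e3]; simpa [m2] using m1)
    (by rw [r3 1 (by omega)]; exact hok.right (disjoint_halfKeys hq hne)) rep3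
  rw [r3 1 (by omega), applyFlag_union, hfin] at rep4
  have m4' : AdjRep n (s4.mem 0) g := by rw [m4, e3]; simpa [m2] using m1
  -- set the adjacency
  have q4 : ∀ r < 5, s4.regs r = s.regs r := fun r hr => (r4 r hr).trans (r3 r hr)
  obtain ⟨hb, hbo, hbm⟩ := setAdj_spec (s := s4) (e := .reg 1) (c := f) hW
    ((q4 0 (by omega)).trans h.size) ((q4 2 (by omega)).trans hu') ((q4 3 (by omega)).trans hv') hu hv
    (by simp [q4]; rfl) (by simp [q4]; rfl)
  refine ⟨(setAdj (.reg 1)).run W s4, hbefore.seq (hr2.seq (hswap.seq (hr4.seq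
    (Cmd.Simple.reaches (by simp [setAdj, Cmd.Simple]) s4)))), ?_, ?_, ?_, ?_⟩
  · rw [hb.regs, q4 0 (by omega), h.size]
  · rw [hb.regs, q4 4 (by omega), h.group]
  · rw [hbm]
    exact m4'.set hu hv (Or.inl rfl) huv hvu f
  · exact Represents.congr rep4 (fun a h0 => hb.mem a (by simpa using h0)) hbo

/-! ### The empty graph, the group size and the initialization. -/

theorem inv_start (q : ℕ) :
    Inv n q (fun _ _ => False) ((MState.start n).setReg 4 q) := by
  have hk : keys n q (fun _ _ => False) = ∅ := by simp [keys]
  refine ⟨by simp [MState.start], by simp, fun x y _ => by simp [MState.start], ?_, ?_⟩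
  · intro κ _
    rw [hk]
    exact ⟨by simp, by simp, by simp, by simp [MState.start], by simp [MState.start]⟩
  · have : ∀ κ, contrib n ((MState.start n).setReg 4 q).mem κ = 0 := fun κ => by
      simp [contrib, MState.start]
    simp only [this, Finset.sum_const_zero]
    exact ⟨by simp, by simp [MState.start], by simp [MState.start]⟩

/-- The size of the groups: the square root of the number of nodes, rounded up. -/
def groupSize (n : ℕ) : ℕ := Nat.find (p := fun q => n ≤ q * q) ⟨n, Nat.le_mul_self n⟩

theorem le_groupSize_sq (n : ℕ) : n ≤ groupSize n * groupSize n :=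
  Nat.find_spec (p := fun q => n ≤ q * q) ⟨n, Nat.le_mul_self n⟩

theorem sq_lt_of_lt_groupSize {n j : ℕ} (h : j < groupSize n) : j * j < n :=
  not_le.1 (Nat.find_min (p := fun q => n ≤ q * q) ⟨n, Nat.le_mul_self n⟩ h)

theorem groupSize_le (n : ℕ) : groupSize n ≤ n :=
  Nat.find_min' (p := fun q => n ≤ q * q) ⟨n, Nat.le_mul_self n⟩ (Nat.le_mul_self n)

theorem groupSize_pos {n : ℕ} (hn : 0 < n) : 0 < groupSize n := by
  rcases Nat.eq_zero_or_pos (groupSize n) with h | h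
  · have := le_groupSize_sq n
    rw [h] at this
    omega
  · exact h

/-- The time for the initialization. -/
def initBound (q : ℕ) : ℕ := q * (initCond.cost + 1 + initBody.bound) + (initCond.cost + 1)

theorem init_spec (hW : Fits W n) (ω : ℕ → ℕ) :
    ∃ s, Reaches W ω init (MState.start n) s (initBound (groupSize n)) ∧
      Inv n (groupSize n) (fun _ _ => False) s := by
  have b1 := hW.one_lt
  have b2 := hW.square
  have b3 : 3 * n ≤ n ^ 2 := by rw [pow_two]; exact Nat.mul_le_mul_right _ hW.pos
  have hq := groupSize_le n
  have hsq : ∀ j ≤ groupSize n, j * j < W := fun j hj => by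
    have h1 : j * j ≤ n * n := Nat.mul_le_mul (hj.trans hq) (hj.trans hq)
    have h2 := hW.pos
    rw [← pow_two n] at h1
    omega
  obtain ⟨s, hr, rfl⟩ := Reaches.loop (W := W) (ω := ω) (e := initCond) (p := initBody)
    (b := initBody.bound) (fun j t => t = (MState.start n).setReg 4 j) (groupSize n)
    (fun t ht => by
      subst ht
      simp [initCond, MState.start, Nat.mod_eq_of_lt (hsq _ le_rfl), (le_groupSize_sq n).not_gt])
    (fun j hj t ht => by
      subst ht
      refine ⟨?_, _, Cmd.Simple.reaches (by simp [initBody, Cmd.Simple]) _, ?_⟩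
      · simp [initCond, MState.start, Nat.mod_eq_of_lt (hsq _ hj.le), sq_lt_of_lt_groupSize hj,
          Nat.mod_eq_of_lt b1]
      · simp [initBody, Cmd.run, MState.setReg, Nat.mod_eq_of_lt b1,
          Nat.mod_eq_of_lt (show j + 1 < W by omega)])
    -- Register `4` is zero at the start, so the loop invariant holds with `j = 0`.
    0 (Nat.zero_le _) (MState.start n) (by
      simp only [MState.setReg, MState.start, MState.mk.injEq, and_self, and_true]
      ext r
      by_cases hr : r = 4 <;> simp [hr])
  exact ⟨_, hr, inv_start _⟩

end Prog

/-! ## Runs on update sequences -/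

/-- The adjacency relation of a graph, as a relation on the natural numbers. -/
def adjOf {n : ℕ} (G : SimpleGraph (Fin n)) (x y : ℕ) : Prop :=
  ∃ (hx : x < n) (hy : y < n), G.Adj ⟨x, hx⟩ ⟨y, hy⟩

theorem isAdj_adjOf {n : ℕ} (G : SimpleGraph (Fin n)) : IsAdj n (adjOf G) :=
  ⟨fun ⟨hx, _, _⟩ => hx, fun ⟨hx, hy, h⟩ => ⟨hy, hx, h.symm⟩, fun _ ⟨_, _, h⟩ => G.irrefl h⟩

@[simp] theorem adjOf_val {n : ℕ} (G : SimpleGraph (Fin n)) (u v : Fin n) :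
    adjOf G u v ↔ G.Adj u v := ⟨fun ⟨_, _, h⟩ => h, fun h => ⟨u.2, v.2, h⟩⟩

theorem adjOf_sup_edge {n : ℕ} (G : SimpleGraph (Fin n)) {u v : Fin n} (hne : u ≠ v) :
    adjOf (G ⊔ SimpleGraph.edge u v) = addEdge (adjOf G) u v := by
  ext x y
  simp only [adjOf, addEdge, SimpleGraph.sup_adj, SimpleGraph.edge_adj, Fin.ext_iff]
  constructor
  · rintro ⟨hx, hy, h | ⟨h, -⟩⟩
    · exact Or.inl ⟨hx, hy, h⟩
    · omega
  · rintro (⟨hx, hy, h⟩ | ⟨rfl, rfl⟩ | ⟨rfl, rfl⟩)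
    · exact ⟨hx, hy, Or.inl h⟩
    · exact ⟨u.2, v.2, Or.inr ⟨by simp, fun h => hne h⟩⟩
    · exact ⟨v.2, u.2, Or.inr ⟨by simp, fun h => hne h.symm⟩⟩

theorem addEdge_adjOf_deleteEdges {n : ℕ} (G : SimpleGraph (Fin n)) {u v : Fin n} (h : G.Adj u v) :
    adjOf G = addEdge (adjOf (G.deleteEdges {s(u, v)})) u v := by
  ext x y
  simp only [adjOf, addEdge, SimpleGraph.deleteEdges_adj, Set.mem_singleton_iff, Sym2.eq_iff,
    Fin.ext_iff]
  constructor
  · rintro ⟨hx, hy, h'⟩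
    by_cases h0 : x = u ∧ y = v ∨ x = v ∧ y = u
    · exact Or.inr h0
    · exact Or.inl ⟨hx, hy, h', h0⟩
  · rintro (⟨hx, hy, h', -⟩ | ⟨rfl, rfl⟩ | ⟨rfl, rfl⟩)
    · exact ⟨hx, hy, h'⟩
    · exact ⟨u.2, v.2, h⟩
    · exact ⟨v.2, u.2, h.symm⟩

namespace Prog

variable {W n : ℕ} {s : MState}

theorem update_step (hW : Fits W n) {q : ℕ} (ω : ℕ → ℕ) (hq : 0 < q) (hqn : q ≤ n)
    {G : SimpleGraph (Fin n)} {e : EdgeUpdate n} (he : e.Legal G) (h : Inv n q (adjOf G) s) :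
    ∃ s', Reaches W ω update (s.feed e) s' (updateBound q) ∧ Inv n q (adjOf (e.apply G)) s' := by
  cases e with
  | insert u v =>
    obtain ⟨hne, huv⟩ := he
    have := update_spec (s := s.feed (.insert u v)) (g := adjOf G) hW (isAdj_adjOf G) ω hq hqn
      (u := u) (v := v) (by simp [MState.feed]) (by simp [MState.feed]) u.2 v.2 (by simpa using huv)
      (fun h' => hne (Fin.ext h')) (by
        have : (s.feed (.insert u v)).regs 1 ≠ 0 := by simp [MState.feed]
        rw [if_neg this]
        exact ⟨by simpa [MState.feed] using h.size, by simpa [MState.feed] using h.group, h.adj,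
          h.rep.1, h.rep.2⟩)
    rw [if_neg (by simp [MState.feed])] at this
    rwa [EdgeUpdate.apply, adjOf_sup_edge G hne]
  | delete u v =>
    have := update_spec (s := s.feed (.delete u v)) (g := adjOf (G.deleteEdges {s(u, v)})) hW
      (isAdj_adjOf _) ω hq hqn (u := u) (v := v) (by simp [MState.feed]) (by simp [MState.feed])
      u.2 v.2 (by simp) (fun h' => G.ne_of_adj he (Fin.ext h')) (by
        have : (s.feed (.delete u v)).regs 1 = 0 := by simp [MState.feed]
        rw [if_pos this, ← addEdge_adjOf_deleteEdges G he]
        exact ⟨by simpa [MState.feed] using h.size, by simpa [MState.feed] using h.group, h.adj,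
          h.rep.1, h.rep.2⟩)
    rwa [if_pos (by simp [MState.feed])] at this

theorem exists_run (hW : Fits W n) (ω : ℕ → ℕ) (σ : ℕ → EdgeUpdate n)
    (hσ : ∀ t, (σ t).Legal (graphAt σ t)) :
    ∃ (st : ℕ → MState) (k₀ : ℕ) (k : ℕ → ℕ), spanner.IsRun W ω σ st k₀ k ∧
      k₀ ≤ initBound (groupSize n) ∧ (∀ t, k t ≤ updateBound (groupSize n)) ∧
      ∀ t, Inv n (groupSize n) (adjOf (graphAt σ t)) (st t) := by
  have hn : 0 < n := by have := hW.pos; omega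
  obtain ⟨s₀, ⟨k₀, hk₀, h₀⟩, hs₀⟩ := init_spec hW ω
  have hbot : adjOf (graphAt σ 0) = fun _ _ => False := by
    ext x y
    simp [adjOf, graphAt]
  rw [← hbot] at hs₀
  choose next hnext hinv using fun t (s : {s // Inv n (groupSize n) (adjOf (graphAt σ t)) s}) =>
    update_step hW ω (groupSize_pos hn) (groupSize_le n) (hσ t) s.2
  -- Each state is carried together with its invariant, which guarantees that the next update halts.
  let st : ∀ t, {s // Inv n (groupSize n) (adjOf (graphAt σ t)) s} := fun t =>
    Nat.rec ⟨s₀, hs₀⟩ (fun t s => ⟨next t s, hinv t s⟩) t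
  choose k hk hex using fun t => hnext t (st t)
  exact ⟨fun t => (st t).1, k₀, k, ⟨h₀, hex⟩, hk₀, hk, fun t => (st t).2⟩

end Prog

/-! ## The output is a sparse spanner -/

section

variable {n q : ℕ} {g : ℕ → ℕ → Prop}

theorem decode_key {n a b i : ℕ} (hb : b < n) (hi : i < n) :
    ((a * n + b) * n + i) / n / n = a ∧ ((a * n + b) * n + i) / n % n = b := by
  have h1 : ((a * n + b) * n + i) / n = a * n + b := by
    rw [mul_comm, Nat.mul_add_div (by omega), Nat.div_eq_of_lt hi, add_zero]
  rw [h1]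
  constructor
  · rw [mul_comm, Nat.mul_add_div (by omega), Nat.div_eq_of_lt hb, add_zero]
  · rw [Nat.mul_add_mod', Nat.mod_eq_of_lt hb]

theorem decode_pairKey {u x : ℕ} (hu : u < n) (hx : x < n) :
    pairKey n u x / n / n = min u x ∧ pairKey n u x / n % n = max u x :=
  decode_key (i := 0) (by omega) (by omega)

theorem decode_leadKey {u v : ℕ} (hu : u < n) (hv : v < n) :
    leadKey n q u v / n / n = u ∧ leadKey n q u v / n % n = u :=
  decode_key hu ((Nat.div_le_self _ _).trans_lt hv)

theorem adj_of_mem_keys (hg : IsAdj n g) {κ w : ℕ} (h : (κ, w) ∈ keys n q g) :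
    κ < n ^ 3 ∧ g (κ / n / n) w ∧ g (κ / n % n) w := by
  rcases h with ⟨a, b, h1, h2, h3, h4, h5⟩ | ⟨a, h1, h2⟩
  · simp only at h3 h4 h5
    subst h5
    obtain ⟨e1, e2⟩ := decode_pairKey (hg.lt h3) (hg.lt h4)
    rw [e1, e2, min_eq_left h1.le, max_eq_right h1.le]
    exact ⟨pairKey_lt (hg.lt h3) (hg.lt h4), h3, h4⟩
  · simp only at h1 h2
    subst h2
    obtain ⟨e1, e2⟩ := decode_leadKey (q := q) (hg.lt h1) (hg.lt' h1)
    rw [e1, e2]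
    exact ⟨leadKey_lt (hg.lt h1) (hg.lt' h1), h1, h1⟩

/-- A list that is not empty has a first element, and the output consists of the edges from the first
elements to the nodes encoded by the numbers of the lists. -/
theorem Represents.mem_out {T : Set (ℕ × ℕ)} {s : MState} (h : Represents n T s) (e : Sym2 ℕ) :
    e ∈ s.out ↔ ∃ κ < n ^ 3, (κ, s.mem 2 (κ * n)) ∈ T ∧ s.mem 1 κ ≠ 0 ∧
      (e = s(κ / n / n, s.mem 2 (κ * n)) ∨ e = s(κ / n % n, s.mem 2 (κ * n))) := by
  rw [h.counts.mem_out]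
  constructor
  · rintro ⟨p, hp, rfl⟩
    obtain ⟨κ, hκ, hp⟩ := Multiset.mem_sum.1 hp
    rw [Finset.mem_range] at hκ
    unfold contrib at hp
    split_ifs at hp with h0
    · simp at hp
    · have := (h.lists κ hκ).mem 0 (Nat.pos_of_ne_zero h0)
      rw [add_zero] at this
      refine ⟨κ, hκ, this, h0, ?_⟩
      simp only [Multiset.mem_cons, Multiset.mem_singleton] at hp
      rcases hp with rfl | rfl
      · exact Or.inl rfl
      · exact Or.inr rfl
  · rintro ⟨κ, hκ, -, h0, h1⟩
    have hsub : ∀ p ∈ contrib n s.mem κ, p ∈ ∑ κ ∈ Finset.range (n ^ 3), contrib n s.mem κ :=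
      fun p hp => Multiset.mem_sum.2 ⟨κ, Finset.mem_range.2 hκ, hp⟩
    rcases h1 with rfl | rfl
    · exact ⟨_, hsub (κ / n / n, s.mem 2 (κ * n)) (by simp [contrib, h0]), rfl⟩
    · exact ⟨_, hsub (κ / n % n, s.mem 2 (κ * n)) (by simp [contrib, h0]), rfl⟩

theorem Represents.exists_head {T : Set (ℕ × ℕ)} {s : MState} (h : Represents n T s) {κ w : ℕ}
    (hκ : κ < n ^ 3) (hw : (κ, w) ∈ T) :
    ∃ y, (κ, y) ∈ T ∧ s(κ / n / n, y) ∈ s.out ∧ s(κ / n % n, y) ∈ s.out := by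
  have hc : 0 < s.mem 1 κ := lt_of_le_of_lt (Nat.zero_le _) ((h.lists κ hκ).pos_lt w hw)
  have hm := (h.lists κ hκ).mem 0 hc
  rw [add_zero] at hm
  exact ⟨_, hm, (h.mem_out _).2 ⟨κ, hκ, hm, hc.ne', Or.inl rfl⟩,
    (h.mem_out _).2 ⟨κ, hκ, hm, hc.ne', Or.inr rfl⟩⟩

theorem Represents.adj_of_mem_out (hg : IsAdj n g) {s : MState} (h : Represents n (keys n q g) s)
    {e : Sym2 ℕ} (he : e ∈ s.out) : ∃ x y, g x y ∧ e = s(x, y) := by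
  obtain ⟨κ, hκ, hm, -, h1 | h1⟩ := (h.mem_out e).1 he
  · exact ⟨_, _, (adj_of_mem_keys hg hm).2.1, h1⟩
  · exact ⟨_, _, (adj_of_mem_keys hg hm).2.2, h1⟩

theorem Represents.adj_of_mk_mem_out (hg : IsAdj n g) {s : MState} (h : Represents n (keys n q g) s)
    {x y : ℕ} (he : s(x, y) ∈ s.out) : g x y := by
  obtain ⟨a, b, hab, h1⟩ := h.adj_of_mem_out hg he
  rcases Sym2.eq_iff.1 h1 with ⟨rfl, rfl⟩ | ⟨rfl, rfl⟩
  · exact hab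
  · exact hg.symm hab

/-- The end points of an edge of the graph are joined by a path of length three in the output, unless
they are adjacent there. -/
theorem Represents.exists_path (hg : IsAdj n g) {s : MState} (h : Represents n (keys n q g) s)
    {u v : ℕ} (huv : g u v) : s(u, v) ∈ s.out ∨
      ∃ y z, s(v, y) ∈ s.out ∧ s(y, z) ∈ s.out ∧ s(z, u) ∈ s.out := by
  have hu := hg.lt huv
  have hv := hg.lt' huv
  obtain ⟨y, hy, hy', -⟩ := h.exists_head (leadKey_lt hv hu)
    (show (leadKey n q v u, u) ∈ keys n q g from Or.inr ⟨v, hg.symm huv, rfl⟩)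
  rw [(decode_leadKey hv hu).1] at hy'
  have hvy := h.adj_of_mk_mem_out hg hy'
  rcases eq_or_ne y u with rfl | hne
  · left
    rwa [Sym2.eq_swap]
  right
  have hyn := hg.lt' hvy
  have hgrp : y / q = u / q := by
    rcases hy with ⟨a, b, h1, h2, h3, h4, h5⟩ | ⟨a, h1, h2⟩
    · exact absurd h5.symm (pairKey_ne_leadKey (hg.lt h3) (hg.lt h4) hv hu h1.ne)
    · exact (leadKey_inj (hg.lt h1) hv hyn hu h2.symm).2
  -- The node `v` itself shows that the list of common neighbours of `u` and `y` is not empty.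
  have hp : (pairKey n u y, v) ∈ keys n q g := by
    rcases lt_or_gt_of_ne hne with hlt | hlt
    · exact Or.inl ⟨y, u, hlt, hgrp, hg.symm hvy, huv, pairKey_comm _ _ _⟩
    · exact Or.inl ⟨u, y, hlt, hgrp.symm, huv, hg.symm hvy, rfl⟩
  obtain ⟨z, -, h1, h2⟩ := h.exists_head (pairKey_lt hu hyn) hp
  rw [(decode_pairKey hu hyn).1] at h1
  rw [(decode_pairKey hu hyn).2] at h2
  refine ⟨y, z, hy', ?_⟩
  rw [Sym2.eq_swap (a := z)]
  rcases le_total u y with hle | hle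
  · rw [min_eq_left hle] at h1
    rw [max_eq_right hle] at h2
    exact ⟨h2, h1⟩
  · rw [min_eq_right hle] at h1
    rw [max_eq_left hle] at h2
    exact ⟨h1, h2⟩

/-- A pair within a group is given by one node and the residue of the other modulo `q`; a list of
neighbours by a node and a group number, which is below `q` because `n ≤ q * q`. This gives at most
`2 * (n * q)` lists with two edges each. -/
theorem Represents.card_out_le (hg : IsAdj n g) (hq : 0 < q) (hnq : n ≤ q * q) {s : MState}
    (h : Represents n (keys n q g) s) : s.out.card ≤ 4 * (n * q) := by
  set F := Finset.range n ×ˢ Finset.range q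
  set K := F.image (fun p => pairKey n p.1 (p.1 / q * q + p.2)) ∪
    F.image (fun p => (p.1 * n + p.1) * n + p.2) with hK
  have hF : F.card = n * q := by simp [F]
  have hKc : K.card ≤ 2 * (n * q) := by
    have h1 := Finset.card_union_le (F.image (fun p => pairKey n p.1 (p.1 / q * q + p.2)))
      (F.image (fun p => (p.1 * n + p.1) * n + p.2))
    rw [← hK] at h1
    have h2 := Finset.card_image_le (s := F) (f := fun p => pairKey n p.1 (p.1 / q * q + p.2))
    have h3 := Finset.card_image_le (s := F) (f := fun p => (p.1 * n + p.1) * n + p.2)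
    omega
  have hsub : s.out ⊆ K.image (fun κ => s(κ / n / n, s.mem 2 (κ * n))) ∪
      K.image (fun κ => s(κ / n % n, s.mem 2 (κ * n))) := by
    intro e he
    obtain ⟨κ, hκ, hm, -, h1⟩ := (h.mem_out e).1 he
    have hκK : κ ∈ K := by
      rw [hK, Finset.mem_union, Finset.mem_image, Finset.mem_image]
      rcases hm with ⟨a, b, h1, h2, h3, h4, h5⟩ | ⟨a, h1, h2⟩
      · left
        refine ⟨(a, b % q), ?_, ?_⟩
        · simp [F, hg.lt h3, Nat.mod_lt _ hq]
        · simp only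
          rw [h2, Nat.div_add_mod', ← h5]
      · right
        refine ⟨(a, s.mem 2 (κ * n) / q), ?_, h2.symm⟩
        have : s.mem 2 (κ * n) / q < q := by
          rw [Nat.div_lt_iff_lt_mul hq]
          exact (hg.lt' h1).trans_le hnq
        simp [F, hg.lt h1, this]
    rcases h1 with rfl | rfl
    · exact Finset.mem_union_left _ (Finset.mem_image_of_mem _ hκK)
    · exact Finset.mem_union_right _ (Finset.mem_image_of_mem _ hκK)
  have h1 := (Finset.card_le_card hsub).trans (Finset.card_union_le _ _)
  have h2 := Finset.card_image_le (s := K) (f := fun κ => s(κ / n / n, s.mem 2 (κ * n)))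
  have h3 := Finset.card_image_le (s := K) (f := fun κ => s(κ / n % n, s.mem 2 (κ * n)))
  omega

end

/-- It suffices to check the stretch on the edges. -/
theorem edist_le_mul_edist {V : Type*} {G H : SimpleGraph V} {α : ℕ} (hα : α ≠ 0)
    (h : ∀ u v, G.Adj u v → H.edist u v ≤ α) (u v : V) : H.edist u v ≤ α * G.edist u v := by
  have hw : ∀ {u v : V} (p : G.Walk u v), H.edist u v ≤ α * (p.length : ℕ∞) := by
    intro u v p
    induction p with
    | nil => simp
    | cons hadj p ih =>
      refine SimpleGraph.edist_triangle.trans ((add_le_add (h _ _ hadj) ih).trans ?_)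
      rw [SimpleGraph.Walk.length_cons]
      push_cast
      rw [mul_add, mul_one, add_comm]
  by_cases hr : G.Reachable u v
  · obtain ⟨p, hp⟩ := hr.exists_walk_length_eq_edist
    rw [← hp]
    exact hw p
  -- Here `α ≠ 0` matters, since `0 * ⊤ = 0`.
  · rw [SimpleGraph.edist_eq_top_of_not_reachable hr, ENat.mul_top (by exact_mod_cast hα)]
    exact le_top

theorem Represents.exists_spanner {n q : ℕ} {G : SimpleGraph (Fin n)} {s : MState} (hq : 0 < q)
    (hnq : n ≤ q * q) (h : Represents n (keys n q (adjOf G)) s) :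
    ∃ H : SimpleGraph (Fin n), s.Outputs H ∧ IsSpanner 3 G H ∧ H.edgeSet.ncard ≤ 4 * (n * q) := by
  have hg := isAdj_adjOf G
  let H : SimpleGraph (Fin n) :=
    { Adj := fun x y => s((x : ℕ), (y : ℕ)) ∈ s.out
      symm := ⟨fun x y hxy => by rwa [Sym2.eq_swap]⟩
      loopless := ⟨fun x hx => hg.irrefl _ (h.adj_of_mk_mem_out hg hx)⟩ }
  have hout : s.Outputs H := by
    ext e
    simp only [Finset.mem_coe, Set.mem_image]
    constructor
    · intro he
      obtain ⟨x, y, ⟨hx, hy, -⟩, rfl⟩ := h.adj_of_mem_out hg he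
      exact ⟨s(⟨x, hx⟩, ⟨y, hy⟩), he, rfl⟩
    · rintro ⟨e, he, rfl⟩
      induction e with
      | h x y => exact he
  refine ⟨H, hout, ⟨fun x y hxy => (adjOf_val G x y).1 (h.adj_of_mk_mem_out hg hxy), ?_⟩, ?_⟩
  · refine edist_le_mul_edist three_ne_zero fun u v huv => ?_
    rcases h.exists_path hg ((adjOf_val G u v).2 huv) with h1 | ⟨y, z, h1, h2, h3⟩
    · have : H.Adj u v := h1
      rw [SimpleGraph.edist_eq_one_iff_adj.2 this]
      norm_num
    · obtain ⟨hz, hy, -⟩ := hg.symm (h.adj_of_mk_mem_out hg h2)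
      have a1 : H.Adj v ⟨y, hy⟩ := h1
      have a2 : H.Adj ⟨y, hy⟩ ⟨z, hz⟩ := h2
      have a3 : H.Adj ⟨z, hz⟩ u := h3
      rw [SimpleGraph.edist_comm]
      exact ((SimpleGraph.Walk.cons a1 (.cons a2 (.cons a3 .nil))).edist_le)
  · have h1 := h.card_out_le hg hq hnq
    have h2 : (s.out : Set (Sym2 ℕ)).ncard = H.edgeSet.ncard := by
      rw [hout]
      exact Set.ncard_image_of_injective _ (Sym2.map.injective Fin.val_injective)
    rwa [← h2, Set.ncard_coe_finset]

/-! ## The bounds -/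

namespace Prog

/-- By minimality `(q - 1) ^ 2 < n` for the group size `q`, hence `q ≤ √n + 1 ≤ 2 * √n`. -/
theorem groupSize_le_sqrt {n : ℕ} (hn : 0 < n) : (groupSize n : ℝ) ≤ 2 * (n : ℝ) ^ (1 / 2 : ℝ) := by
  have hpos := groupSize_pos hn
  have h1 := sq_lt_of_lt_groupSize (show groupSize n - 1 < groupSize n by omega)
  have h2 : ((groupSize n - 1 : ℕ) : ℝ) ≤ (n : ℝ) ^ (1 / 2 : ℝ) := by
    rw [← Real.sqrt_eq_rpow]
    apply Real.le_sqrt_of_sq_le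
    rw [pow_two]
    exact_mod_cast h1.le
  have h3 : (1 : ℝ) ≤ (n : ℝ) ^ (1 / 2 : ℝ) :=
    Real.one_le_rpow (by exact_mod_cast hn) (by norm_num)
  rw [Nat.cast_sub hpos, Nat.cast_one] at h2
  linarith

/-- The bound is affine in `q` with nonnegative coefficients. -/
theorem halfBound_le {q : ℕ} (hq : 0 < q) : halfBound q ≤ halfBound 1 * q := by
  unfold halfBound
  nlinarith [Nat.zero_le lead.bound, Nat.zero_le cond.cost]

theorem updateBound_le {q : ℕ} (hq : 0 < q) : updateBound q ≤ updateBound 1 * q := by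
  unfold updateBound
  have := halfBound_le hq
  have h1 := Nat.le_mul_of_pos_right before.bound hq
  have h2 := Nat.le_mul_of_pos_right swap.bound hq
  have h3 := Nat.le_mul_of_pos_right (setAdj (.reg 1)).bound hq
  simp only [add_mul]
  omega

theorem initBound_le {q : ℕ} (hq : 0 < q) : initBound q ≤ initBound 1 * q := by
  unfold initBound
  nlinarith [Nat.zero_le initCond.cost]

/-- Of the six factors `n`, four cover the index of a list entry and two cover the constant, as `9 ≤
n ^ 2`. -/
theorem fits_wordLength {n : ℕ} (hn : 3 ≤ n) : Fits (2 ^ wordLength 6 n) n := by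
  refine ⟨hn, ?_⟩
  have h1 : n < 2 ^ (Nat.log 2 n + 1) := Nat.lt_pow_succ_log_self (by norm_num) n
  calc 9 * n ^ 4 ≤ n ^ 2 * n ^ 4 := Nat.mul_le_mul_right _ (Nat.pow_le_pow_left hn 2)
    _ = n ^ 6 := by ring
    _ ≤ (2 ^ (Nat.log 2 n + 1)) ^ 6 := Nat.pow_le_pow_left h1.le 6
    _ = 2 ^ wordLength 6 n := by rw [← pow_mul, wordLength, mul_comm]

end Prog

theorem one_lt_log_three : 1 < Real.log 3 := by
  rw [Real.lt_log_iff_exp_lt (by norm_num)]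
  linarith [Real.exp_one_lt_d9]

open Prog in
theorem mainTheorem3 (a : ℕ) :
    ∃ (A : DynAlgorithm) (c C : ℕ), 1 ≤ c ∧
      ∀ n : ℕ, 3 ≤ n →
        ∀ σ : ℕ → EdgeUpdate n, (∀ t, (σ t).Legal (graphAt σ t)) →
          ∃ (st : (ℕ → Fin (2 ^ wordLength c n)) → ℕ → MState)
            (k₀ : (ℕ → Fin (2 ^ wordLength c n)) → ℕ)
            (k : (ℕ → Fin (2 ^ wordLength c n)) → ℕ → ℕ),
            (∀ ω, A.IsRun (2 ^ wordLength c n) (fun i => (ω i : ℕ)) σ (st ω) (k₀ ω) (k ω)) ∧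
            (∀ ω, k₀ ω ≤ C * n ^ C) ∧
            (∀ ω t, (k ω t : ℝ) ≤ C * (n : ℝ) ^ (1 / 2 : ℝ) * Real.log n ^ 4) ∧
            ∀ t₀ : ℕ,
              randomWords (wordLength c n)
                {ω | ¬ ∀ t, t₀ ≤ t → t ≤ t₀ + n ^ a →
                  ∃ H : SimpleGraph (Fin n),
                    (st ω t).Outputs H ∧ IsSpanner 5 (graphAt σ t) H ∧
                    (H.edgeSet.ncard : ℝ) ≤
                      C * ((n : ℝ) ^ (1 + 1 / 2 : ℝ) * Real.log n ^ (1 / 2 : ℝ) *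
                        Real.log (Real.log n))} ≤
                ENNReal.ofReal (1 / (n : ℝ) ^ a) := by
  have hδ : 0 < Real.log (Real.log 3) := Real.log_pos one_lt_log_three
  -- There are at most `4 * n * q` edges and `q ≤ 2 * √n`, whence the `8`; the double logarithm is
  -- smallest at `n = 3`.
  obtain ⟨B, hB⟩ := exists_nat_ge (8 / Real.log (Real.log 3))
  rw [div_le_iff₀ hδ] at hB
  -- The factor `2` again comes from `q ≤ 2 * √n`; the summand `1` makes the exponent positive, so
  -- that `n ≤ n ^ C`.
  refine ⟨spanner, 6, initBound 1 + 2 * updateBound 1 + B + 1, by norm_num, fun n hn σ hσ => ?_⟩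
  set C := initBound 1 + 2 * updateBound 1 + B + 1 with hC
  have hn0 : 0 < n := by omega
  have hn1 : (3 : ℝ) ≤ n := by exact_mod_cast hn
  have hlog3 : Real.log 3 ≤ Real.log n := Real.log_le_log (by norm_num) hn1
  have hlog : 1 ≤ Real.log n := one_lt_log_three.le.trans hlog3
  have hloglog : Real.log (Real.log 3) ≤ Real.log (Real.log n) :=
    Real.log_le_log (by linarith [one_lt_log_three]) hlog3
  have hqpos := groupSize_pos hn0
  have hqle := groupSize_le_sqrt hn0
  have hsqrt : 0 ≤ (n : ℝ) ^ (1 / 2 : ℝ) := by positivity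
  choose st k₀ k hrun hk₀ hk hinv using fun ω : ℕ → Fin (2 ^ wordLength 6 n) =>
    exists_run (fits_wordLength hn) (fun i => (ω i : ℕ)) σ hσ
  refine ⟨st, k₀, k, hrun, fun ω => ?_, fun ω t => ?_, fun t₀ => ?_⟩
  · calc k₀ ω ≤ initBound 1 * groupSize n := (hk₀ ω).trans (initBound_le hqpos)
      _ ≤ C * n ^ C := Nat.mul_le_mul (by omega)
          ((groupSize_le n).trans (Nat.le_self_pow (by omega) n))
  · have h1 : (k ω t : ℝ) ≤ updateBound 1 * groupSize n := by
      exact_mod_cast (hk ω t).trans (updateBound_le hqpos)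
    have h2 : 2 * (updateBound 1 : ℝ) ≤ C := by
      have : 2 * updateBound 1 ≤ C := by omega
      exact_mod_cast this
    calc (k ω t : ℝ) ≤ updateBound 1 * (2 * (n : ℝ) ^ (1 / 2 : ℝ)) :=
          h1.trans (mul_le_mul_of_nonneg_left hqle (by positivity))
      _ = 2 * updateBound 1 * (n : ℝ) ^ (1 / 2 : ℝ) := by ring
      _ ≤ C * (n : ℝ) ^ (1 / 2 : ℝ) := mul_le_mul_of_nonneg_right h2 hsqrt
      _ ≤ C * (n : ℝ) ^ (1 / 2 : ℝ) * Real.log n ^ 4 :=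
          le_mul_of_one_le_right (by positivity) (one_le_pow₀ hlog)
  -- The output is a spanner for every `ω`, so the event has measure zero.
  · refine le_of_eq_of_le ?_ zero_le
    convert measure_empty (μ := randomWords (wordLength 6 n))
    refine Set.eq_empty_of_forall_notMem fun ω hω => hω fun t _ _ => ?_
    obtain ⟨H, h1, ⟨h2, h3⟩, h4⟩ := (hinv ω t).rep.exists_spanner hqpos (le_groupSize_sq n)
    refine ⟨H, h1, ⟨h2, fun u v => (h3 u v).trans (mul_le_mul_left (by norm_num) _)⟩, ?_⟩
    have h5 : (H.edgeSet.ncard : ℝ) ≤ 4 * (n * groupSize n) := by exact_mod_cast h4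
    have h6 : (n : ℝ) ^ (1 + 1 / 2 : ℝ) = n * (n : ℝ) ^ (1 / 2 : ℝ) := by
      rw [Real.rpow_add (by positivity), Real.rpow_one]
    have h7 : (1 : ℝ) ≤ Real.log n ^ (1 / 2 : ℝ) := Real.one_le_rpow hlog (by norm_num)
    have h8 : (8 : ℝ) ≤ C * Real.log (Real.log n) := by
      have : (B : ℝ) ≤ C := by
        have : B ≤ C := by omega
        exact_mod_cast this
      exact hB.trans (mul_le_mul this hloglog hδ.le (by positivity))
    calc (H.edgeSet.ncard : ℝ) ≤ 4 * (n * (2 * (n : ℝ) ^ (1 / 2 : ℝ))) :=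
          h5.trans (by gcongr)
      _ = 8 * (n : ℝ) ^ (1 + 1 / 2 : ℝ) := by rw [h6]; ring
      _ ≤ C * Real.log (Real.log n) * (n : ℝ) ^ (1 + 1 / 2 : ℝ) :=
          mul_le_mul_of_nonneg_right h8 (by positivity)
      _ ≤ C * Real.log (Real.log n) * (n : ℝ) ^ (1 + 1 / 2 : ℝ) * Real.log n ^ (1 / 2 : ℝ) :=
          le_mul_of_one_le_right (mul_nonneg (by linarith) (by positivity)) h7
      _ = _ := by ring
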